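/- Let $d\ge 1$, let $\widetilde{\mathcal Z}\subset\mathbb R^d$ be a closed ball of positive radius centred at the origin, and let $\mathcal Z\subset\widetilde{\mathcal Z}$ be compact. Let $f:\widetilde{\mathcal Z}\times\widetilde{\mathcal Z}\to\mathbb R$ be symmetric, continuous and nonnegative-definite. Assume: 1. for all $x\ne y$ in $\mathcal Z$ there is $a\in\mathcal Z$ with $f(x,a)\neq f(y,a)$; 2. $f$ is $C^2$ on $\widetilde{\mathcal Z}\times\widetilde{\mathcal Z}$ (with one-sided derivatives at the boundary), and for every $z\in\mathcal Z$ the matrix $\mathbf H_z$ with entries $\mathbf H_z^{ij}=\left.\frac{\partial^2 f}{\partial x^{(i)}\partial y^{(j)}}\right|_{(z,z)}$ is positive definite. Then there exist (Mercer) numbers $\lambda_k\ge 0$ and functions $u_k:\widetilde{\mathcal Z}\to\mathbb R$, $k\ge1$, orthonormal in $L^2(\widetilde{\mathcal Z},dx)$, such that $f(x,y)=\sum_{k\ge1}\lambda_k u_k(x)u_k(y)$ absolutely and uniformly on $\widetilde{\mathcal Z}\times\widetilde{\mathcal Z}$. For every such choice, let $\phi:\mathcal Z\to\ell_2$ be the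 feature map $\phi(x)=(\lambda_k^{1/2}u_k(x))_{k\ge1}$ and let $\mathcal M=\phi(\mathcal Z)$. Then $\phi$ is a homeomorphism from $\mathcal Z$ onto $\mathcal M$, and $\phi$ and $\phi^{-1}$ are Lipschitz. A path in $\mathcal M$ (or in $\mathcal Z$) is a continuous map from $[0,1]$ to that set; a partition is a sequence $0=t_0\le t_1\le\dots\le t_n=1$; the length $l$ of a path is the supremum over all partitions of the sums of the norms of its increments ($\|\cdot\|_2$ in $\ell_2$, $\|\cdot\|$ Euclidean in $\mathbb R^d$). Let $\gamma$ be any path in $\mathcal M$ with $l(\gamma)<\infty$ and put $\eta_t=\phi^{-1}(\gamma_t)$. Then $\eta$ is a path in $\mathcal Z$ with $l(\eta)<\infty$. For every $\epsilon>0$ there is a partition $\mathcal P_\epsilon$ such that for every partition $\mathcal P=(t_0,\dots,t_n)$ whose set of points contains that of $\mathcal P_\epsilon$, $$\left|\,l(\gamma)-\sum_{k=1}^n\left\langle \eta_{t_k}-\eta_{t_{k-1}},\ \mathbf H_{\eta_{t_{k-1}}}(\eta_{t_k}-\eta_{t_{k-1}})\right\rangle^{1/2}\right|\le\epsilon .$$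 If $\gamma$ and $\eta$ are continuously differentiable on $[0,1]$ (one-sidedly at the end-points), then $$l(\gamma)=\int_0^1\|\dot\gamma_t\|_2\,dt=\int_0^1\langle\dot\eta_t,\mathbf H_{\eta_t}\dot\eta_t\rangle^{1/2}\,dt .$$ -/

import Mathlib

open Set Metric MeasureTheory Filter
open scoped ENNReal NNReal

noncomputable section

namespace KernelGeometry

/-- The real Hilbert space of square-summable real sequences. -/
abbrev EllTwo : Type := lp (fun _ : ℕ => ℝ) 2

/-- `f` is a symmetric, continuous, nonnegative-definite kernel on the closed ball of radius `r`
centred at the origin; values of `f` outside this ball are irrelevant. -/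
structure IsKernelOn {d : ℕ} (r : ℝ)
    (f : EuclideanSpace ℝ (Fin d) → EuclideanSpace ℝ (Fin d) → ℝ) : Prop where
  symm : ∀ x ∈ closedBall (0 : EuclideanSpace ℝ (Fin d)) r,
    ∀ y ∈ closedBall (0 : EuclideanSpace ℝ (Fin d)) r, f x y = f y x
  continuousOn : ContinuousOn
    (fun p : EuclideanSpace ℝ (Fin d) × EuclideanSpace ℝ (Fin d) => f p.1 p.2)
    (closedBall 0 r ×ˢ closedBall 0 r)
  nonneg : ∀ (n : ℕ) (x : Fin n → EuclideanSpace ℝ (Fin d)) (c : Fin n → ℝ),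
    (∀ i, x i ∈ closedBall (0 : EuclideanSpace ℝ (Fin d)) r) →
      0 ≤ ∑ i, ∑ j, c i * c j * f (x i) (x j)

/-- A Mercer expansion of `f` on the closed ball of radius `r`: nonnegative numbers and
`L²`-orthonormal functions (Lebesgue measure on the ball) such that
`f x y = ∑ k, eigval k * eigfun k x * eigfun k y`, absolutely and uniformly on the ball. -/
structure MercerExpansion {d : ℕ} (r : ℝ)
    (f : EuclideanSpace ℝ (Fin d) → EuclideanSpace ℝ (Fin d) → ℝ) where
  eigval : ℕ → ℝ
  eigfun : ℕ → EuclideanSpace ℝ (Fin d) → ℝ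
  eigval_nonneg : ∀ k, 0 ≤ eigval k
  memLp : ∀ k, MemLp (eigfun k) 2 (volume.restrict (closedBall 0 r))
  orthonormal : ∀ j k,
    ∫ x in closedBall (0 : EuclideanSpace ℝ (Fin d)) r, eigfun j x * eigfun k x
      = if j = k then 1 else 0
  summable_abs : ∀ x ∈ closedBall (0 : EuclideanSpace ℝ (Fin d)) r,
    ∀ y ∈ closedBall (0 : EuclideanSpace ℝ (Fin d)) r,
      Summable fun k => |eigval k * eigfun k x * eigfun k y|
  tendstoUniformlyOn : TendstoUniformlyOn
    (fun (n : ℕ) (p : EuclideanSpace ℝ (Fin d) × EuclideanSpace ℝ (Fin d)) =>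
      ∑ k ∈ Finset.range n, eigval k * eigfun k p.1 * eigfun k p.2)
    (fun p => f p.1 p.2) atTop (closedBall 0 r ×ˢ closedBall 0 r)

/-- The sequence of coordinates of the feature map is square-summable on the ball. -/
theorem MercerExpansion.memEllTwo {d : ℕ} {r : ℝ}
    {f : EuclideanSpace ℝ (Fin d) → EuclideanSpace ℝ (Fin d) → ℝ} (m : MercerExpansion r f)
    {x : EuclideanSpace ℝ (Fin d)} (hx : x ∈ closedBall (0 : EuclideanSpace ℝ (Fin d)) r) :
    Memℓp (fun k : ℕ => √(m.eigval k) * m.eigfun k x) 2 := by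
  apply memℓp_gen
  refine (m.summable_abs x hx x hx).congr fun k => ?_
  have h := Real.sq_sqrt (m.eigval_nonneg k)
  have h2 : m.eigval k * m.eigfun k x * m.eigfun k x
      = (√(m.eigval k) * m.eigfun k x) ^ 2 := by
    rw [mul_pow, h]; ring
  simp [h2]

/-- The Mercer feature map `x ↦ (√(eigval k) * eigfun k x)ₖ`, restricted to a subset `Z` of the
ball. -/
def MercerExpansion.featureMap {d : ℕ} {r : ℝ}
    {f : EuclideanSpace ℝ (Fin d) → EuclideanSpace ℝ (Fin d) → ℝ} (m : MercerExpansion r f)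
    {Z : Set (EuclideanSpace ℝ (Fin d))} (hZ : Z ⊆ closedBall 0 r) (z : Z) : EllTwo :=
  ⟨fun k : ℕ => √(m.eigval k) * m.eigfun k z, m.memEllTwo (hZ z.2)⟩

/-- The matrix of mixed second partial derivatives `∂²f / ∂x⁽ⁱ⁾∂y⁽ʲ⁾` at `(z, z)`. Derivatives are
taken within the closed ball, so that they are one-sided when `z` lies on the boundary sphere. -/
def mixedHessian {d : ℕ} (r : ℝ)
    (f : EuclideanSpace ℝ (Fin d) → EuclideanSpace ℝ (Fin d) → ℝ)
    (z : EuclideanSpace ℝ (Fin d)) : Matrix (Fin d) (Fin d) ℝ :=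
  Matrix.of fun i j =>
    fderivWithin ℝ
      (fun x => fderivWithin ℝ (fun y => f x y) (closedBall 0 r) z (EuclideanSpace.single j 1))
      (closedBall 0 r) z (EuclideanSpace.single i 1)

/-- The Riemannian length element `⟨v, H_z v⟩ ^ (1/2)`. -/
def metricNorm {d : ℕ} (r : ℝ)
    (f : EuclideanSpace ℝ (Fin d) → EuclideanSpace ℝ (Fin d) → ℝ)
    (z v : EuclideanSpace ℝ (Fin d)) : ℝ :=
  √(inner ℝ v (Matrix.toEuclideanLin (mixedHessian r f z) v))

/-- A partition of `[0, 1]`: a nondecreasing sequence `0 = t₀ ≤ … ≤ tₙ = 1`. -/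
structure Partition where
  n : ℕ
  t : Fin (n + 1) → unitInterval
  mono : Monotone t
  first : t 0 = 0
  last : t (Fin.last n) = 1

/-- The length of a curve: the supremum over all partitions of the lengths of the inscribed
polygons. -/
def pathLength {X : Type*} [PseudoEMetricSpace X] (γ : unitInterval → X) : ℝ≥0∞ :=
  ⨆ P : Partition, ∑ k : Fin P.n, edist (γ (P.t k.succ)) (γ (P.t k.castSucc))

end KernelGeometry

end

namespace KernelGeometry

/-! Since `⟨φ x, φ y⟩ = f x y`, the squared chord `‖φ x - φ y‖²` is the second difference `f x x - f
x y - f y x + f y y`. For `C²` kernels this equals `⟨x - y, H_y (x - y)⟩` up to `ε² ‖x - y‖²`,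
uniformly near the diagonal (`exists_abs_second_difference_sub_le`). Taking roots, chord and length
element differ by at most `ε ‖x - y‖` (`MercerExpansion.exists_abs_dist_sub_metricNorm_le`).

Bi-Lipschitz bounds: `H` is uniformly positive definite on the compact set `Z`, which settles nearby
pairs. The remaining pairs form a compact set, on which the second difference is positive because
`φ` is injective.

Length: `η` is rectifiable because `φ⁻¹` is Lipschitz. On fine partitions the two sums then differ
by at most `ε l(η)`, and the chord sums approach `l(γ)`. For `C¹` curves, dividing the same
comparison by the time increment identifies the two speeds, and length is the integral of speed.

Existence of the expansion: write `K x y = ⟨Φ x, Φ y⟩` in the reproducing kernel space `H`. The map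
`S : H → L²`, `h ↦ ⟨h, Φ ·⟩`, is compact and injective. If `b k` are the eigenvectors of `S S*`, the
nonzero `S* (b k)`, normalised, form a Hilbert basis of `H`. Parseval expands `K` pointwise, and
Dini makes the convergence uniform. -/

open Topology

/-! ### Spectral theory and Mercer's theorem -/

/-- A compact self-adjoint operator has an orthonormal Hilbert basis of eigenvectors. -/
theorem exists_hilbertBasis_eigenvectors.{u} {E : Type u} [NormedAddCommGroup E]
    [InnerProductSpace ℝ E] [CompleteSpace E] {T : E →L[ℝ] E} (hT : IsCompactOperator T)
    (hT' : T.IsSymmetric) :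
    ∃ (ι : Type u) (b : HilbertBasis ι ℝ E) (c : ι → ℝ), ∀ i, T (b i) = c i • b i := by
  have hcl : ∀ μ : ℝ, CompleteSpace (Module.End.eigenspace (T : Module.End ℝ E) μ) := fun μ => by
    have : IsClosed ((Module.End.eigenspace (T : Module.End ℝ E) μ : Submodule ℝ E) : Set E) := by
      have h : ((Module.End.eigenspace (T : Module.End ℝ E) μ : Submodule ℝ E) : Set E)
          = {x | T x = μ • x} := by
        ext x; simp
      rw [h]
      exact isClosed_eq T.continuous (continuous_const_smul μ)
    exact this.completeSpace_coe
  -- All real `μ` are allowed: a trivial eigenspace contributes an empty basis.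
  choose w b hb using fun μ : ℝ =>
    exists_hilbertBasis ℝ (Module.End.eigenspace (T : Module.End ℝ E) μ)
  have ho := (hT'.orthogonalFamily_eigenspaces).orthonormal_sigma_orthonormal
    (v_family := fun μ => (b μ)) (fun μ => (b μ).orthonormal)
  refine ⟨_, HilbertBasis.mkOfOrthogonalEqBot ho ?_, Sigma.fst, fun a => ?_⟩
  · rw [← ContinuousLinearMap.orthogonalComplement_iSup_eigenspaces_eq_bot hT hT']
    refine le_antisymm ?_ (Submodule.orthogonal_le ?_)
    · intro x hx
      rw [Submodule.mem_orthogonal'] at hx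
      rw [Submodule.mem_orthogonal']
      intro u hu
      have : (⨆ μ, Module.End.eigenspace (T : Module.End ℝ E) μ) ≤ (ℝ ∙ x)ᗮ := by
        refine iSup_le fun μ y hy => ?_
        rw [Submodule.mem_orthogonal_singleton_iff_inner_right]
        have := (b μ).hasSum_repr ⟨y, hy⟩
        have h2 := (this.mapL ((innerSL ℝ x).comp
          (Module.End.eigenspace (T : Module.End ℝ E) μ).subtypeL))
        refine h2.unique ?_
        convert hasSum_zero with i
        have := hx (b μ i) (Submodule.subset_span ⟨⟨μ, i⟩, rfl⟩)
        simp [this]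
      exact (Submodule.mem_orthogonal_singleton_iff_inner_right.1 (this hu))
    · rw [Submodule.span_le]
      rintro _ ⟨⟨μ, i⟩, rfl⟩
      exact Submodule.mem_iSup_of_mem μ (b μ i).2
  · rw [HilbertBasis.coe_mkOfOrthogonalEqBot]
    exact Module.End.mem_eigenspace_iff.1 (b a.1 a.2).2

/-- Orthonormal vectors are `√2` apart, so balls of radius `1/2` about them are disjoint, and
separability allows only countably many. -/
theorem countable_of_orthonormal {ι E : Type*} [NormedAddCommGroup E]
    [InnerProductSpace ℝ E] [TopologicalSpace.SeparableSpace E] {v : ι → E}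
    (hv : Orthonormal ℝ v) : Countable ι := by
  have hd : ∀ i j, i ≠ j → 1 < dist (v i) (v j) := fun i j hij => by
    have h : ‖v i - v j‖ ^ 2 = 2 := by
      rw [@norm_sub_sq ℝ, hv.2 hij, hv.1, hv.1]; norm_num
    rw [dist_eq_norm]
    nlinarith [norm_nonneg (v i - v j)]
  have := Set.PairwiseDisjoint.countable_of_isOpen (s := fun i => ball (v i) (1 / 2))
    (a := (univ : Set ι)) (fun i _ j _ hij => ball_disjoint_ball (by linarith [hd i j hij]))
    (fun i _ => isOpen_ball) (fun i _ => ⟨v i, mem_ball_self (by norm_num)⟩)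
  exact countable_univ_iff.1 this

/-- The feature map of a symmetric nonnegative-definite kernel into its reproducing kernel Hilbert
space. -/
theorem exists_hilbert_featureMap.{u} {X : Type u} (K : X → X → ℝ) (hsymm : ∀ x y, K x y = K y x)
    (hnonneg : ∀ (n : ℕ) (x : Fin n → X) (c : Fin n → ℝ),
      0 ≤ ∑ i, ∑ j, c i * c j * K (x i) (x j)) :
    ∃ (H : Type u) (_ : NormedAddCommGroup H) (_ : InnerProductSpace ℝ H) (_ : CompleteSpace H)
      (Φ : X → H), (∀ x y, inner ℝ (Φ x) (Φ y) = K x y) ∧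
        ∀ h, (∀ x, inner ℝ h (Φ x) = 0) → h = 0 := by
  -- `RKHS` takes operator-valued kernels, so each value of `K` is read as multiplication on `ℝ`.
  let M : Matrix X X (ℝ →L[ℝ] ℝ) := Matrix.of fun x y => K x y • (1 : ℝ →L[ℝ] ℝ)
  have hM : M.PosSemidef := by
    have key : M.IsHermitian ∧ ∀ v : X →₀ ℝ,
        0 ≤ RCLike.re (v.sum fun x w => v.sum fun x' w' => inner ℝ (M x' x w) w') := by
      refine ⟨?_, fun v => ?_⟩
      · ext x y
        simp [M, Matrix.conjTranspose_apply, hsymm x y]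
      · have h := hnonneg v.support.card (fun i => (v.support.equivFin.symm i : X))
          (fun i => v (v.support.equivFin.symm i))
        have e : ∀ F : v.support → ℝ, ∑ i, F (v.support.equivFin.symm i) = ∑ i, F i :=
          fun F => Equiv.sum_comp _ F
        rw [e fun a => ∑ j, v a * v (v.support.equivFin.symm j) * K a (v.support.equivFin.symm j)]
          at h
        simp_rw [fun a : v.support => e fun b => v a * v b * K a b] at h
        rw [Finset.sum_coe_sort v.support fun a => ∑ b : v.support, v a * v b * K a b] at h
        simp_rw [fun a : X => Finset.sum_coe_sort v.support fun b => v a * v b * K a b] at h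
        refine h.trans_eq ?_
        simp only [Finsupp.sum, M, RCLike.re_to_real]
        refine Finset.sum_congr rfl fun a _ => Finset.sum_congr rfl fun b _ => ?_
        simp [hsymm a b]; ring
    exact ((RKHS.posSemidef_tfae (𝕜 := ℝ) (K := M)).out 0 2).2 key
  have : Fact M.PosSemidef := ⟨hM⟩
  refine ⟨RKHS.OfKernel M, inferInstance, inferInstance, inferInstance,
    fun x => RKHS.kerFun (RKHS.OfKernel M) x 1, fun x y => ?_, fun h hh => ?_⟩
  · rw [hsymm, ← RKHS.kernel_inner, RKHS.OfKernel.kernel_ofKernel]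
    simp [M]
  · apply RKHS.ext
    intro x
    have := hh x
    rw [RKHS.inner_kerFun] at this
    simpa using this

open scoped BoundedContinuousFunction

/-- Pairing with a continuous family of vectors over a compact space, as an operator into the
bounded continuous functions. -/
noncomputable def evalAlong {X H : Type*} [TopologicalSpace X] [CompactSpace X]
    [NormedAddCommGroup H] [InnerProductSpace ℝ H] (Φ : C(X, H)) : H →L[ℝ] (X →ᵇ ℝ) :=
  LinearMap.mkContinuous
    { toFun := fun h =>
        BoundedContinuousFunction.mkOfCompact ⟨fun x => inner ℝ h (Φ x), by fun_prop⟩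
      map_add' := fun a b => by ext x; simp [inner_add_left]
      map_smul' := fun r a => by ext x; simp [inner_smul_left] } ‖Φ‖ (fun h => by
    refine (BoundedContinuousFunction.norm_le (by positivity)).2 fun x => ?_
    refine (norm_inner_le_norm h (Φ x)).trans ?_
    rw [mul_comm]
    exact mul_le_mul_of_nonneg_right (Φ.norm_coe_le_norm x) (norm_nonneg h))

@[simp] theorem evalAlong_apply {X H : Type*} [TopologicalSpace X] [CompactSpace X]
    [NormedAddCommGroup H] [InnerProductSpace ℝ H] (Φ : C(X, H)) (h : H) (x : X) :
    evalAlong Φ h x = inner ℝ h (Φ x) := rfl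

/-- Arzelà–Ascoli: by Cauchy–Schwarz, the functions `⟨h, Φ ·⟩` with `‖h‖ ≤ 1` are bounded by `‖Φ‖`
and inherit equicontinuity from `Φ`. -/
theorem isCompactOperator_evalAlong {X H : Type*} [TopologicalSpace X] [CompactSpace X]
    [NormedAddCommGroup H] [InnerProductSpace ℝ H] (Φ : C(X, H)) :
    IsCompactOperator (evalAlong Φ) := by
  refine (isCompactOperator_iff_isCompact_closure_image_closedBall (𝕜₁ := ℝ) (evalAlong Φ :
    H →ₗ[ℝ] (X →ᵇ ℝ)) zero_lt_one).2 ?_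
  refine BoundedContinuousFunction.arzela_ascoli (closedBall 0 ‖Φ‖)
    (isCompact_closedBall _ _) _ ?_ ?_
  · rintro _ x ⟨h, hh, rfl⟩
    rw [mem_closedBall_zero_iff] at hh ⊢
    refine (norm_inner_le_norm h (Φ x)).trans ?_
    nlinarith [Φ.norm_coe_le_norm x, norm_nonneg h, norm_nonneg (Φ x)]
  · intro x₀
    rw [Metric.equicontinuousAt_iff_right]
    intro ε hε
    filter_upwards [Metric.tendsto_nhds.1 (Φ.continuous.tendsto x₀) ε hε] with x hx
    rintro ⟨_, h, hh, rfl⟩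
    rw [mem_closedBall_zero_iff] at hh
    rw [dist_comm, dist_eq_norm] at hx
    change dist (inner ℝ h (Φ x₀)) (inner ℝ h (Φ x)) < ε
    rw [Real.dist_eq, ← inner_sub_right]
    refine lt_of_le_of_lt (abs_real_inner_le_norm h _) ?_
    nlinarith [norm_nonneg (Φ x₀ - Φ x)]

/-- On the diagonal the terms are squares, so Dini applies. Off it, `(a k x ± a k y)² ≥ 0` bounds
twice the remainder at `(x, y)` by the sum of the remainders at `(x, x)` and `(y, y)`. -/
theorem tendstoUniformly_sum_mul_of_hasSum {X : Type*} [TopologicalSpace X] [CompactSpace X]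
    {K : X → X → ℝ} (hK : Continuous fun x => K x x) {a : ℕ → X → ℝ}
    (ha : ∀ k, Continuous (a k)) (hs : ∀ x y, HasSum (fun k => a k x * a k y) (K x y)) :
    TendstoUniformly (fun n (p : X × X) => ∑ k ∈ Finset.range n, a k p.1 * a k p.2)
      (fun p => K p.1 p.2) atTop := by
  have hD : TendstoUniformly (fun n x => ∑ k ∈ Finset.range n, a k x * a k x)
      (fun x => K x x) atTop := by
    refine Monotone.tendstoUniformly_of_forall_tendsto (fun n => by fun_prop) ?_ hK
      fun x => (hs x x).tendsto_sum_nat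
    intro m n hmn x
    exact Finset.sum_le_sum_of_subset_of_nonneg (Finset.range_mono hmn)
      fun k _ _ => mul_self_nonneg _
  rw [Metric.tendstoUniformly_iff] at hD ⊢
  intro ε hε
  filter_upwards [hD ε hε] with n hn
  rintro ⟨x, y⟩
  have hx := (abs_lt.1 (hn x)).2
  have hy := (abs_lt.1 (hn y)).2
  have key : ∀ s : ℝ, s ^ 2 = 1 →
      (∑ k ∈ Finset.range n, a k x * a k x + ∑ k ∈ Finset.range n, a k y * a k y) +
        2 * s * ∑ k ∈ Finset.range n, a k x * a k y ≤ (K x x + K y y) + 2 * s * K x y := by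
    intro s hs1
    have h1 := ((hs x x).add (hs y y)).add ((hs x y).mul_left (2 * s))
    have h2 := sum_le_hasSum (Finset.range n) (fun k _ => by
      nlinarith [sq_nonneg (a k x + s * a k y)]) h1
    simpa [Finset.sum_add_distrib, Finset.mul_sum] using h2
  have h1 := key 1 (by norm_num)
  have h2 := key (-1) (by norm_num)
  simp only [Real.dist_eq]
  rw [abs_lt]
  constructor <;> linarith

/-- **Mercer's theorem** on a compact space with a finite measure of full support. -/
theorem exists_mercer {X : Type*} [TopologicalSpace X] [CompactSpace X]
    [SecondCountableTopology X] [MeasurableSpace X] [BorelSpace X] (μ : Measure X)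
    [IsFiniteMeasure μ] [μ.IsOpenPosMeasure] (hinf : ¬ FiniteDimensional ℝ (Lp ℝ 2 μ))
    (K : X → X → ℝ) (hK : Continuous fun p : X × X => K p.1 p.2)
    (hsymm : ∀ x y, K x y = K y x)
    (hnonneg : ∀ (n : ℕ) (x : Fin n → X) (c : Fin n → ℝ),
      0 ≤ ∑ i, ∑ j, c i * c j * K (x i) (x j)) :
    ∃ (c : ℕ → ℝ) (u : ℕ → X → ℝ), (∀ k, 0 ≤ c k) ∧ (∀ k, MemLp (u k) 2 μ) ∧
      (∀ j k, ∫ x, u j x * u k x ∂μ = if j = k then 1 else 0) ∧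
      (∀ x y, Summable fun k => |c k * u k x * u k y|) ∧
      TendstoUniformly (fun n (p : X × X) => ∑ k ∈ Finset.range n, c k * u k p.1 * u k p.2)
        (fun p => K p.1 p.2) atTop := by
  obtain ⟨H, _, _, _, φ, hφ, hφ0⟩ := exists_hilbert_featureMap K hsymm hnonneg
  have hKc : ∀ y, Continuous fun x => K x y := fun y =>
    hK.comp (continuous_id.prodMk continuous_const)
  have hKd : Continuous fun x => K x x := hK.comp (continuous_id.prodMk continuous_id)
  have hφc : Continuous φ := by
    rw [continuous_iff_continuousAt]
    intro y
    rw [ContinuousAt, tendsto_iff_norm_sub_tendsto_zero]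
    have h : ∀ x, ‖φ x - φ y‖ = √(K x x - 2 * K x y + K y y) := fun x => by
      rw [← hφ, ← hφ, ← hφ, real_inner_self_eq_norm_sq, real_inner_self_eq_norm_sq,
        ← norm_sub_sq_real, Real.sqrt_sq (norm_nonneg _)]
    simp_rw [h]
    have h2 : Continuous fun x => √(K x x - 2 * K x y + K y y) := by
      have := hKc y
      fun_prop
    have h3 := h2.tendsto y
    rwa [show K y y - 2 * K y y + K y y = 0 by ring, Real.sqrt_zero] at h3
  let Φ : C(X, H) := ⟨φ, hφc⟩
  let S : H →L[ℝ] Lp ℝ 2 μ := (BoundedContinuousFunction.toLp 2 μ ℝ).comp (evalAlong Φ)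
  have hSae : ∀ h, S h =ᵐ[μ] fun x => inner ℝ h (φ x) := fun h =>
    BoundedContinuousFunction.coeFn_toLp (p := 2) μ (𝕜 := ℝ) (evalAlong Φ h)
  have hSc : IsCompactOperator S :=
    (isCompactOperator_evalAlong Φ).clm_comp (BoundedContinuousFunction.toLp 2 μ ℝ)
  -- Full support enters here: a continuous function vanishing almost everywhere vanishes
  -- identically.
  have hS0 : ∀ h, S h = 0 → h = 0 := by
    intro h hh
    refine hφ0 h ?_
    have h1 : (fun x => inner ℝ h (φ x)) =ᵐ[μ] fun _ => (0 : ℝ) := by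
      refine (hSae h).symm.trans ?_
      rw [hh]
      exact Lp.coeFn_zero _ _ _
    have h2 := (Continuous.ae_eq_iff_eq μ (by fun_prop) continuous_const).1 h1
    exact congrFun h2
  have hadj : ∀ h v, inner ℝ h (S.adjoint v) = inner ℝ (S h) v := fun h v =>
    ContinuousLinearMap.adjoint_inner_right S h v
  have hTs : (S ∘L S.adjoint).IsSymmetric := fun v w => by
    change inner ℝ (S (S.adjoint v)) w = inner ℝ v (S (S.adjoint w))
    rw [← hadj, real_inner_comm _ v, ← hadj, real_inner_comm]
  obtain ⟨ι, b, c, hb⟩ := exists_hilbertBasis_eigenvectors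
    (T := S ∘L S.adjoint) (hSc.comp_clm S.adjoint) hTs
  have : Fact ((2 : ℝ≥0∞) ≠ ∞) := ⟨by simp⟩
  have hιc : Countable ι := countable_of_orthonormal b.orthonormal
  -- Infinite dimension lets the eigenbasis be indexed by exactly `ℕ`.
  have hιi : Infinite ι := by
    by_contra hfin
    rw [not_infinite_iff_finite] at hfin
    have := Fintype.ofFinite ι
    exact hinf (Module.Finite.of_basis b.toOrthonormalBasis.toBasis)
  obtain ⟨e⟩ : Nonempty (ℕ ≃ ι) := by
    obtain ⟨d⟩ := nonempty_denumerable ι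
    exact ⟨(Denumerable.eqv ι).symm⟩
  set g : ℕ → H := fun k => S.adjoint (b (e k)) with hg
  set l : ℕ → ℝ := fun k => c (e k) with hl
  have hSg : ∀ k, S (g k) = l k • b (e k) := fun k => hb (e k)
  have hgg : ∀ j k, inner ℝ (g j) (g k) = if j = k then l k else 0 := fun j k => by
    change inner ℝ (g j) (S.adjoint (b (e k))) = _
    rw [hadj, hSg, inner_smul_left]
    rcases eq_or_ne j k with rfl | hjk
    · simp [b.orthonormal.1]
    · rw [b.orthonormal.2 (e.injective.ne hjk)]
      simp [hjk]
  have hl0 : ∀ k, 0 ≤ l k := fun k => by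
    have := hgg k k
    rw [if_pos rfl] at this
    rw [← this]
    exact real_inner_self_nonneg
  have hg0 : ∀ k, l k = 0 → g k = 0 := fun k hk => by
    have := hgg k k
    rw [if_pos rfl, hk] at this
    exact inner_self_eq_zero.1 this
  set a : ℕ → X → ℝ := fun k x => (√(l k))⁻¹ * inner ℝ (g k) (φ x) with ha
  have hac : ∀ k, Continuous (a k) := fun k => by simp only [ha]; fun_prop
  -- Parseval for `φ x` and `φ y` in the basis of normalised `g k` with `l k ≠ 0`. Completeness: `h`
  -- orthogonal to every `g k` has `S h` orthogonal to every `b i`, so `h = 0`.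
  have hsum : ∀ x y, HasSum (fun k => a k x * a k y) (K x y) := by
    let v : {k : ℕ // l k ≠ 0} → H := fun k => (√(l k))⁻¹ • g k
    have hsq : ∀ k : {k : ℕ // l k ≠ 0}, √(l k) * √(l k) = l k := fun k =>
      Real.mul_self_sqrt (hl0 k)
    have hv : Orthonormal ℝ v := by
      rw [orthonormal_iff_ite]
      intro j k
      simp only [v, inner_smul_left, inner_smul_right, hgg, RCLike.conj_to_real]
      rcases eq_or_ne j k with rfl | hjk
      · have h1 := hsq j
        have h2 : √(l j) ≠ 0 := fun h => j.2 (by rw [← h1, h, zero_mul])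
        simp only [if_true]
        field_simp
        rw [sq, h1]
      · have : (j : ℕ) ≠ k := fun h => hjk (Subtype.ext h)
        simp [hjk, this]
    let B := HilbertBasis.mkOfOrthogonalEqBot hv (by
      rw [Submodule.eq_bot_iff]
      intro h hh
      rw [Submodule.mem_orthogonal'] at hh
      apply hS0
      have h1 : ∀ k, inner ℝ h (g k) = 0 := fun k => by
        by_cases hk : l k = 0
        · simp [hg0 k hk]
        · have := hh (v ⟨k, hk⟩) (Submodule.subset_span ⟨_, rfl⟩)
          simp only [v, inner_smul_right, mul_eq_zero, inv_eq_zero] at this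
          refine this.resolve_left fun h0 => hk ?_
          rw [← Real.mul_self_sqrt (hl0 k), h0, zero_mul]
      have h2 : ∀ i, inner ℝ (S h) (b i) = 0 := fun i => by
        rw [← hadj]
        simpa [hg] using h1 (e.symm i)
      have h3 := b.hasSum_inner_mul_inner (S h) (S h)
      simp only [h2, zero_mul] at h3
      exact inner_self_eq_zero.1 (h3.unique hasSum_zero))
    intro x y
    have h1 := B.hasSum_inner_mul_inner (φ x) (φ y)
    rw [hφ] at h1
    have h2 : (fun i => inner ℝ (φ x) (B i) * inner ℝ (B i) (φ y))
        = (fun k => a k x * a k y) ∘ (Subtype.val : {k : ℕ // l k ≠ 0} → ℕ) := by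
      funext k
      simp only [B, HilbertBasis.coe_mkOfOrthogonalEqBot, v, ha, Function.comp, inner_smul_right,
        inner_smul_left, RCLike.conj_to_real, real_inner_comm (g k) (φ x)]
    rw [h2, Subtype.val_injective.hasSum_iff] at h1
    · exact h1
    · intro k hk
      have : l k = 0 := by
        by_contra h
        exact hk ⟨⟨k, h⟩, rfl⟩
      simp [ha, this]
  -- The continuous representative is needed where `l k ≠ 0`. Where `l k = 0` the term vanishes, so
  -- any representative will do.
  let u : ℕ → X → ℝ := fun k => if l k = 0 then b (e k) else
    fun x => (l k)⁻¹ * inner ℝ (g k) (φ x)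
  have hu : ∀ k, u k =ᵐ[μ] b (e k) := fun k => by
    by_cases hk : l k = 0
    · simp [u, hk]
    · have h1 := hSae (g k)
      rw [hSg] at h1
      filter_upwards [h1, Lp.coeFn_smul (l k) (b (e k))] with x hx1 hx2
      simp only [u, hk, if_false]
      rw [← hx1, hx2]
      simp [hk]
  have hua : ∀ k x y, l k * u k x * u k y = a k x * a k y := fun k x y => by
    by_cases hk : l k = 0
    · simp [ha, hk]
    · have h1 := Real.mul_self_sqrt (hl0 k)
      have h2 : √(l k) ≠ 0 := fun h => hk (by rw [← h1, h, zero_mul])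
      simp only [u, hk, if_false, ha]
      nth_rewrite 1 2 3 [← h1]
      field_simp
  refine ⟨l, u, hl0, fun k => (memLp_congr_ae (hu k)).2 (Lp.memLp _), fun j k => ?_,
    fun x y => ?_, ?_⟩
  · have h1 : ∫ x, u j x * u k x ∂μ = inner ℝ (b (e j)) (b (e k)) := by
      rw [L2.inner_def]
      refine integral_congr_ae ?_
      filter_upwards [hu j, hu k] with x h1 h2
      simp [h1, h2, mul_comm]
    classical
    rw [h1, orthonormal_iff_ite.1 b.orthonormal]
    simp
  · simp_rw [hua]
    exact (hsum x y).summable.abs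
  · simp_rw [hua]
    exact tendstoUniformly_sum_mul_of_hasSum hKd hac hsum

/-- An infinite Hausdorff space has infinitely many disjoint nonempty open sets; their indicators
are nonzero and orthogonal. -/
theorem not_finiteDimensional_Lp_two {X : Type*} [TopologicalSpace X] [T2Space X] [Infinite X]
    [MeasurableSpace X] [BorelSpace X] (μ : Measure X) [IsFiniteMeasure μ]
    [μ.IsOpenPosMeasure] : ¬ FiniteDimensional ℝ (Lp ℝ 2 μ) := by
  obtain ⟨U, hUi, hUo, hUd⟩ := exists_seq_infinite_isOpen_pairwise_disjoint X
  let v : ℕ → Lp ℝ 2 μ := fun n =>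
    indicatorConstLp 2 (hUo n).measurableSet (measure_ne_top μ _) (1 : ℝ)
  have hv : ∀ m n, inner ℝ (v m) (v n) = μ.real (U m ∩ U n) := fun m n =>
    L2.real_inner_indicatorConstLp_one_indicatorConstLp_one (hUo m).measurableSet
      (hUo n).measurableSet
  have hli : LinearIndependent ℝ v := by
    refine linearIndependent_of_ne_zero_of_inner_eq_zero (𝕜 := ℝ) (fun n hn => ?_)
      fun m n hmn => ?_
    · have h := hv n n
      rw [hn, inner_zero_left, inter_self] at h
      have h2 : 0 < μ.real (U n) :=
        ENNReal.toReal_pos ((hUo n).measure_pos μ (hUi n).nonempty).ne' (measure_ne_top μ _)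
      exact h2.ne h
    · have h := hv m n
      rwa [(hUd hmn).inter_eq, measureReal_empty] at h
  intro hfin
  exact not_finite_iff_infinite.2 inferInstance hli.finite

theorem isOpenPosMeasure_comap_closedBall {E : Type*} [NormedAddCommGroup E] [NormedSpace ℝ E]
    [MeasurableSpace E] [BorelSpace E] (μ : Measure E) [μ.IsOpenPosMeasure] {r : ℝ} (hr : r ≠ 0) :
    (μ.comap (Subtype.val : closedBall (0 : E) r → E)).IsOpenPosMeasure := by
  refine ⟨fun U hU hne => ?_⟩
  rw [comap_subtype_coe_apply isClosed_closedBall.measurableSet]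
  obtain ⟨V, hV, rfl⟩ := isOpen_induced_iff.1 hU
  obtain ⟨⟨x, hx⟩, hxV⟩ := hne
  have hx' : x ∈ closure (ball (0 : E) r) := by rwa [closure_ball _ hr]
  obtain ⟨y, hyV, hyB⟩ := mem_closure_iff.1 hx' V hV hxV
  have h1 : 0 < μ (V ∩ ball 0 r) := (hV.inter isOpen_ball).measure_pos μ ⟨y, hyV, hyB⟩
  refine (h1.trans_le (measure_mono ?_)).ne'
  rintro z ⟨hzV, hzB⟩
  exact ⟨⟨z, ball_subset_closedBall hzB⟩, hzV, rfl⟩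

theorem nonempty_mercerExpansion {d : ℕ} (hd : 1 ≤ d) {r : ℝ} (hr : 0 < r)
    {f : EuclideanSpace ℝ (Fin d) → EuclideanSpace ℝ (Fin d) → ℝ} (hf : IsKernelOn r f) :
    Nonempty (MercerExpansion r f) := by
  have : Nonempty (Fin d) := ⟨⟨0, hd⟩⟩
  let B : Set (EuclideanSpace ℝ (Fin d)) := closedBall 0 r
  have hBm : MeasurableSet B := isClosed_closedBall.measurableSet
  have hemb := MeasurableEmbedding.subtype_coe hBm
  let μ : Measure B := volume.comap Subtype.val
  have hmap : μ.map Subtype.val = volume.restrict B := map_comap_subtype_coe hBm volume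
  have : CompactSpace B := isCompact_iff_compactSpace.1 (isCompact_closedBall _ _)
  have : IsFiniteMeasure μ := by
    refine ⟨?_⟩
    rw [comap_subtype_coe_apply hBm]
    exact (measure_mono (Subtype.coe_image_subset _ _)).trans_lt measure_closedBall_lt_top
  have : μ.IsOpenPosMeasure := isOpenPosMeasure_comap_closedBall volume hr.ne'
  have : Infinite B :=
    (infinite_of_mem_nhds (0 : EuclideanSpace ℝ (Fin d)) (closedBall_mem_nhds 0 hr)).to_subtype
  obtain ⟨c, u, hc, hu, ho, hs, ht⟩ := exists_mercer μ (not_finiteDimensional_Lp_two μ)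
    (fun x y : B => f x y) (hf.continuousOn.comp_continuous
      (f := fun p : B × B => ((p.1 : EuclideanSpace ℝ (Fin d)), (p.2 : EuclideanSpace ℝ (Fin d))))
      (by fun_prop) fun p => ⟨p.1.2, p.2.2⟩)
    (fun x y => hf.symm x x.2 y y.2) (fun n x a => hf.nonneg n (fun i => x i) a fun i => (x i).2)
  -- Mercer is applied on the ball as a subtype; the eigenfunctions are extended by zero.
  let w : ℕ → EuclideanSpace ℝ (Fin d) → ℝ := fun k => Function.extend Subtype.val (u k) 0
  have hw : ∀ k (x : B), w k x = u k x := fun k x => Subtype.val_injective.extend_apply _ _ x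
  have hwc : ∀ k, w k ∘ (Subtype.val : B → _) = u k := fun k => funext (hw k)
  refine ⟨⟨c, w, hc, fun k => ?_, fun j k => ?_, fun x hx y hy => ?_, ?_⟩⟩
  · rw [← hmap, hemb.memLp_map_measure_iff, hwc]
    exact hu k
  · change ∫ x in B, w j x * w k x = _
    rw [← hmap, hemb.integral_map]
    simp_rw [hw]
    exact ho j k
  · have := hs ⟨x, hx⟩ ⟨y, hy⟩
    simpa [← hw] using this
  · rw [Metric.tendstoUniformlyOn_iff]
    rw [Metric.tendstoUniformly_iff] at ht
    intro ε hε
    filter_upwards [ht ε hε] with n hn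
    rintro ⟨x, y⟩ ⟨hx, hy⟩
    have := hn (⟨x, hx⟩, ⟨y, hy⟩)
    simpa [← hw] using this

/-! ### Second differences near the diagonal -/

section SecondDifference

variable {E : Type*} [NormedAddCommGroup E] [NormedSpace ℝ E]

/-- The mixed second difference of a `C²` function is approximated near the diagonal by the mixed
second derivative, uniformly on a compact convex set. -/
theorem exists_abs_second_difference_sub_le {B : Set E} (hBc : IsCompact B) (hB : Convex ℝ B)
    (hBi : (interior B).Nonempty) {g : E × E → ℝ} (hg : ContDiffOn ℝ 2 g (B ×ˢ B))
    {ε : ℝ} (hε : 0 < ε) :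
    ∃ δ > 0, ∀ x ∈ B, ∀ y ∈ B, dist x y < δ →
      |g (x, x) - g (x, y) - g (y, x) + g (y, y) -
        fderivWithin ℝ (fderivWithin ℝ g (B ×ˢ B)) (B ×ˢ B) (y, y) (x - y, 0) (0, x - y)|
        ≤ ε * ‖x - y‖ ^ 2 := by
  have hBu : UniqueDiffOn ℝ B := uniqueDiffOn_convex hB hBi
  have hu : UniqueDiffOn ℝ (B ×ˢ B) := hBu.prod hBu
  set D := fderivWithin ℝ g (B ×ˢ B) with hD
  have hgd : DifferentiableOn ℝ g (B ×ˢ B) := hg.differentiableOn (by norm_num)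
  have hD1 : ContDiffOn ℝ 1 D (B ×ˢ B) := hg.fderivWithin hu (by norm_num)
  have hDd : DifferentiableOn ℝ D (B ×ˢ B) := hD1.differentiableOn (by norm_num)
  have hD2 : ContinuousOn (fderivWithin ℝ D (B ×ˢ B)) (B ×ˢ B) :=
    hD1.continuousOn_fderivWithin hu (by norm_num)
  have hU : UniformContinuousOn (fderivWithin ℝ D (B ×ˢ B)) (B ×ˢ B) :=
    (hBc.prod hBc).uniformContinuousOn_of_continuous hD2
  obtain ⟨δ, hδ, hδ'⟩ := (Metric.uniformContinuousOn_iff (α := E × E)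
    (β := E × E →L[ℝ] E × E →L[ℝ] ℝ)).1 hU ε hε
  refine ⟨δ, hδ, fun x hx y hy hxy => ?_⟩
  set A := fderivWithin ℝ D (B ×ˢ B) (y, y) with hA
  let s : Set E := B ∩ ball y δ
  have hs : Convex ℝ s := hB.inter (convex_ball y δ)
  have hsB : s ×ˢ s ⊆ B ×ˢ B := prod_mono inter_subset_left inter_subset_left
  have hxs : x ∈ s := ⟨hx, hxy⟩
  have hys : y ∈ s := ⟨hy, mem_ball_self hδ⟩
  -- First mean value inequality, for `D`: its derivative is within `ε` of `A` on `s ×ˢ s`.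
  have h1 : ∀ p ∈ s ×ˢ s, ∀ q ∈ s ×ˢ s, ‖D q - D p - A (q - p)‖ ≤ ε * ‖q - p‖ := by
    intro p hp q hq
    refine (hs.prod hs).norm_image_sub_le_of_norm_hasFDerivWithin_le'
      (f' := fderivWithin ℝ D (B ×ˢ B))
      (fun z hz => ((hDd z (hsB hz)).hasFDerivWithinAt).mono hsB) (fun z hz => ?_) hp hq
    rw [← dist_eq_norm]
    refine (hδ' z (hsB hz) (y, y) ⟨hy, hy⟩ ?_).le
    rw [Prod.dist_eq]
    exact max_lt hz.1.2 hz.2.2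
  have h2 : ∀ a ∈ s, ∀ w ∈ s, HasFDerivWithinAt (fun w => g (a, w))
      ((D (a, w)).comp (ContinuousLinearMap.inr ℝ E E)) s w := by
    intro a ha w hw
    have h3 : HasFDerivWithinAt g (D (a, w)) (B ×ˢ B) (a, w) :=
      (hgd (a, w) ⟨ha.1, hw.1⟩).hasFDerivWithinAt
    exact h3.comp w (hasFDerivAt_prodMk_right a w).hasFDerivWithinAt
      fun w' hw' => ⟨ha.1, hw'.1⟩
  -- Second mean value inequality, in the second variable only: by `h1` the derivative of `g (x, w)
  -- - g (y, w)` stays within `ε * ‖x - y‖` of a fixed functional.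
  have h4 := hs.norm_image_sub_le_of_norm_hasFDerivWithin_le'
    (f := fun w => g (x, w) - g (y, w)) (C := ε * ‖x - y‖)
    (φ := (A (x - y, 0)).comp (ContinuousLinearMap.inr ℝ E E))
    (fun w hw => (h2 x hxs w hw).sub (h2 y hys w hw)) (fun w hw => ?_) hys hxs
  · rw [Real.norm_eq_abs] at h4
    simp only [ContinuousLinearMap.comp_apply, ContinuousLinearMap.inr_apply] at h4
    refine le_trans (le_of_eq ?_) (h4.trans_eq (by ring))
    congr 1
    ring
  · have h5 := h1 (y, w) ⟨hys, hw⟩ (x, w) ⟨hxs, hw⟩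
    rw [Prod.mk_sub_mk, sub_self] at h5
    rw [← ContinuousLinearMap.sub_comp, ← ContinuousLinearMap.sub_comp]
    refine (ContinuousLinearMap.opNorm_comp_le _ _).trans ?_
    refine (mul_le_of_le_one_right (norm_nonneg _)
      (ContinuousLinearMap.norm_inr_le_one ℝ E E)).trans (h5.trans_eq ?_)
    simp [Prod.norm_mk]

/-- A function comparable to the squared distance near the diagonal and positive off the diagonal
of a compact set is comparable to the squared distance on the whole set. -/
theorem exists_sq_dist_bounds {E : Type*} [PseudoMetricSpace E] {Z : Set E}
    (hZ : IsCompact Z) {D : E × E → ℝ}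
    (hD : ContinuousOn D (Z ×ˢ Z)) (hpos : ∀ x ∈ Z, ∀ y ∈ Z, x ≠ y → 0 < D (x, y))
    {δ c C : ℝ} (hδ : 0 < δ) (hc : 0 < c)
    (hloc : ∀ x ∈ Z, ∀ y ∈ Z, dist x y < δ →
      c * dist x y ^ 2 ≤ D (x, y) ∧ D (x, y) ≤ C * dist x y ^ 2) :
    ∃ c' > 0, ∃ C' ≥ 0, ∀ x ∈ Z, ∀ y ∈ Z,
      c' * dist x y ^ 2 ≤ D (x, y) ∧ D (x, y) ≤ C' * dist x y ^ 2 := by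
  let F : Set (E × E) := (Z ×ˢ Z) ∩ {p | δ ≤ dist p.1 p.2}
  have hF : IsCompact F := (hZ.prod hZ).inter_right
    (isClosed_le continuous_const (by fun_prop))
  have hDF : ContinuousOn D F := hD.mono inter_subset_left
  obtain ⟨m, hm, hmD⟩ := hF.exists_forall_le' hDF (a := 0) fun p hp => by
    refine hpos _ hp.1.1 _ hp.1.2 fun h => ?_
    have := hp.2
    simp only [mem_ofPred_eq, h, dist_self] at this
    linarith
  obtain ⟨M, hM⟩ := (hF.image_of_continuousOn hDF).bddAbove
  obtain ⟨R, hR⟩ := ((hZ.prod hZ).image_of_continuousOn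
    (f := fun p : E × E => dist p.1 p.2) (by fun_prop)).bddAbove
  have hRZ : ∀ x ∈ Z, ∀ y ∈ Z, dist x y ≤ R := fun x hx y hy => hR ⟨(x, y), ⟨hx, hy⟩, rfl⟩
  -- On `F` the distance lies between `δ` and `R`, so constant bounds on `D` become quadratic ones;
  -- the `+ 1` keeps the denominator positive.
  refine ⟨min c (m / (R ^ 2 + 1)), lt_min hc (by positivity), max |C| (|M| / δ ^ 2),
    le_max_of_le_left (abs_nonneg C), fun x hx y hy => ?_⟩
  have hd2 : 0 ≤ dist x y ^ 2 := sq_nonneg _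
  rcases lt_or_ge (dist x y) δ with h | h
  · obtain ⟨h1, h2⟩ := hloc x hx y hy h
    exact ⟨(mul_le_mul_of_nonneg_right (min_le_left _ _) hd2).trans h1,
      h2.trans (mul_le_mul_of_nonneg_right ((le_abs_self C).trans (le_max_left _ _)) hd2)⟩
  · have hxyF : (x, y) ∈ F := ⟨⟨hx, hy⟩, h⟩
    constructor
    · refine (mul_le_mul_of_nonneg_right (min_le_right _ _) hd2).trans
        (le_trans ?_ (hmD _ hxyF))
      rw [div_mul_eq_mul_div, div_le_iff₀ (by positivity)]
      refine mul_le_mul_of_nonneg_left ?_ hm.le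
      have : dist x y ^ 2 ≤ R ^ 2 := pow_le_pow_left₀ dist_nonneg (hRZ x hx y hy) 2
      linarith
    · have h1 : D (x, y) ≤ |M| := (hM ⟨_, hxyF, rfl⟩).trans (le_abs_self M)
      refine h1.trans (le_trans ?_ (mul_le_mul_of_nonneg_right (le_max_right _ _) hd2))
      rw [div_mul_eq_mul_div, le_div_iff₀ (by positivity)]
      exact mul_le_mul_of_nonneg_left (pow_le_pow_left₀ hδ.le h 2) (abs_nonneg M)

end SecondDifference

/-! ### The mixed Hessian as a block of the second derivative -/

section Ball

variable {d : ℕ} {r : ℝ} {f : EuclideanSpace ℝ (Fin d) → EuclideanSpace ℝ (Fin d) → ℝ}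

local notation "𝔼" => EuclideanSpace ℝ (Fin d)

/-- The mixed part of the second derivative of a kernel at a point of the diagonal. -/
noncomputable def mixedDeriv (r : ℝ) (f : 𝔼 → 𝔼 → ℝ) (z : 𝔼) : 𝔼 × 𝔼 →L[ℝ] 𝔼 × 𝔼 →L[ℝ] ℝ :=
  fderivWithin ℝ (fderivWithin ℝ (fun p : 𝔼 × 𝔼 => f p.1 p.2) (closedBall 0 r ×ˢ closedBall 0 r))
    (closedBall 0 r ×ˢ closedBall 0 r) (z, z)

theorem uniqueDiffOn_closedBall (hr : 0 < r) : UniqueDiffOn ℝ (closedBall (0 : 𝔼) r) :=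
  uniqueDiffOn_convex (convex_closedBall _ _)
    ⟨0, ball_subset_interior_closedBall (mem_ball_self hr)⟩

theorem continuousOn_mixedDeriv (hr : 0 < r)
    (hC2 : ContDiffOn ℝ 2 (fun p : 𝔼 × 𝔼 => f p.1 p.2) (closedBall 0 r ×ˢ closedBall 0 r)) :
    ContinuousOn (mixedDeriv r f) (closedBall 0 r) := by
  have hu := (uniqueDiffOn_closedBall (d := d) hr).prod (uniqueDiffOn_closedBall (d := d) hr)
  have h1 : ContDiffOn ℝ 1 _ _ := hC2.fderivWithin hu (by norm_num)
  exact (h1.continuousOn_fderivWithin hu (by norm_num)).comp (f := fun z : 𝔼 => (z, z))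
    (by fun_prop) fun z hz => ⟨hz, hz⟩

/-- Chain rule along the slices `y ↦ (x, y)` and `x ↦ (x, z)`; unique differentiability on the ball
covers boundary points. -/
theorem mixedHessian_apply (hr : 0 < r)
    (hC2 : ContDiffOn ℝ 2 (fun p : 𝔼 × 𝔼 => f p.1 p.2) (closedBall 0 r ×ˢ closedBall 0 r))
    {z : 𝔼} (hz : z ∈ closedBall (0 : 𝔼) r) (i j : Fin d) :
    mixedHessian r f z i j =
      mixedDeriv r f z (EuclideanSpace.single i 1, 0) (0, EuclideanSpace.single j 1) := by
  have hB := uniqueDiffOn_closedBall (d := d) hr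
  have hu := hB.prod hB
  have hgd := hC2.differentiableOn (by norm_num)
  have hDd : DifferentiableOn ℝ _ _ :=
    (hC2.fderivWithin (m := 1) hu (by norm_num)).differentiableOn (by norm_num)
  have h1 : ∀ x ∈ closedBall (0 : 𝔼) r,
      fderivWithin ℝ (fun y => f x y) (closedBall 0 r) z (EuclideanSpace.single j 1) =
      fderivWithin ℝ (fun p : 𝔼 × 𝔼 => f p.1 p.2) (closedBall 0 r ×ˢ closedBall 0 r) (x, z)
        (0, EuclideanSpace.single j 1) := by
    intro x hx
    have h2 := (hgd (x, z) ⟨hx, hz⟩).hasFDerivWithinAt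
    have h3 := h2.comp z (hasFDerivAt_prodMk_right x z).hasFDerivWithinAt
      (s := closedBall 0 r) fun w hw => ⟨hx, hw⟩
    change fderivWithin ℝ ((fun p : 𝔼 × 𝔼 => f p.1 p.2) ∘ fun y => (x, y)) _ _ _ = _
    rw [h3.fderivWithin (hB z hz)]
    simp
  rw [mixedHessian, Matrix.of_apply, fderivWithin_congr h1 (h1 z hz)]
  have h2 := (hDd (z, z) ⟨hz, hz⟩).hasFDerivWithinAt
  have h3 := h2.comp (f := fun x => (x, z)) z (hasFDerivAt_prodMk_left z z).hasFDerivWithinAt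
    (s := closedBall 0 r) fun w hw => ⟨hw, hz⟩
  have h4 := h3.clm_apply (hasFDerivWithinAt_const ((0 : 𝔼), EuclideanSpace.single j (1 : ℝ)) z _)
  simp only [Function.comp_def] at h4
  rw [h4.fderivWithin (hB z hz)]
  simp [mixedDeriv]

theorem inner_mixedHessian (hr : 0 < r)
    (hC2 : ContDiffOn ℝ 2 (fun p : 𝔼 × 𝔼 => f p.1 p.2) (closedBall 0 r ×ˢ closedBall 0 r))
    {z : 𝔼} (hz : z ∈ closedBall (0 : 𝔼) r) (v : 𝔼) :
    inner ℝ v (Matrix.toEuclideanLin (mixedHessian r f z) v) = mixedDeriv r f z (v, 0) (0, v) := by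
  have hv : v = ∑ i, v i • EuclideanSpace.single i (1 : ℝ) := by
    ext k
    simp [Pi.single_apply]
  have h1 : (v, (0 : 𝔼)) = ∑ i, v i • (EuclideanSpace.single i (1 : ℝ), (0 : 𝔼)) := by
    ext1
    · simp only [Prod.fst_sum, Prod.smul_fst]; exact hv
    · simp [Prod.snd_sum]
  have h2 : ((0 : 𝔼), v) = ∑ i, v i • ((0 : 𝔼), EuclideanSpace.single i (1 : ℝ)) := by
    ext1
    · simp [Prod.fst_sum]
    · simp only [Prod.snd_sum, Prod.smul_snd]; exact hv
  rw [h1, h2, map_sum (mixedDeriv r f z), sum_apply, PiLp.inner_apply]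
  refine Finset.sum_congr rfl fun i _ => ?_
  rw [map_smul, smul_apply, map_sum]
  simp only [map_smul, ← mixedHessian_apply hr hC2 hz]
  simp [Matrix.toLpLin_apply, Matrix.mulVec, dotProduct, mul_comm]

end Ball

/-! ### Partitions, refinement and length -/

theorem sum_fin_succ_sub_castSucc {G : Type*} [AddCommGroup G] {n : ℕ} (u : Fin (n + 1) → G) :
    ∑ k : Fin n, (u k.succ - u k.castSucc) = u (Fin.last n) - u 0 := by
  induction n with
  | zero => simp
  | succ n ih =>
    rw [Fin.sum_univ_castSucc]
    have h := ih fun k => u k.castSucc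
    simp only [Fin.castSucc_zero, ← Fin.succ_castSucc] at h ⊢
    rw [h]
    simp

theorem sum_edist_comp_le {X : Type*} [PseudoEMetricSpace X] {m n : ℕ} (u : Fin (n + 1) → X)
    {σ : Fin (m + 1) → Fin (n + 1)} (hσ : Monotone σ) :
    ∑ j : Fin m, edist (u (σ j.succ)) (u (σ j.castSucc)) ≤
      ∑ k : Fin n, edist (u k.succ) (u k.castSucc) := by
  -- `Fin.ofNat` reduces modulo `n + 1`, harmlessly: only indices up to `n` occur.
  let c : ℕ → X := fun i => u (Fin.ofNat (n + 1) i)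
  have hc : ∀ k : Fin (n + 1), c k = u k := fun k => by simp [c]
  have h1 : ∑ k : Fin n, edist (u k.succ) (u k.castSucc) =
      ∑ i ∈ Finset.range n, edist (c i) (c (i + 1)) := by
    rw [← Fin.sum_univ_eq_sum_range fun i => edist (c i) (c (i + 1))]
    refine Finset.sum_congr rfl fun k _ => ?_
    rw [edist_comm, ← hc, ← hc]
    simp
  have h2 : ∀ {m : ℕ} (τ : Fin (m + 1) → Fin (n + 1)), Monotone τ →
      ∑ j : Fin m, edist (u (τ j.succ)) (u (τ j.castSucc)) ≤
        ∑ i ∈ Finset.range (τ (Fin.last m)), edist (c i) (c (i + 1)) := by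
    intro m
    induction m with
    | zero => intro τ _; simp
    | succ m ih =>
      intro τ hτ
      rw [Fin.sum_univ_castSucc]
      have h3 := ih (fun j => τ j.castSucc) (hτ.comp Fin.strictMono_castSucc.monotone)
      have h4 : (τ (Fin.last m).castSucc : ℕ) ≤ τ (Fin.last m).succ :=
        hτ (Fin.castSucc_lt_succ).le
      rw [← Fin.succ_last, ← Finset.sum_range_add_sum_Ico _ h4]
      refine add_le_add h3 ?_
      rw [edist_comm, ← hc, ← hc]
      exact edist_le_Ico_sum_edist c h4
  rw [h1]
  refine (h2 σ hσ).trans (Finset.sum_le_sum_of_subset (Finset.range_mono ?_))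
  exact Nat.lt_succ_iff.1 (σ (Fin.last m)).2

theorem Partition.sum_edist_le_of_range_subset {X : Type*} [PseudoEMetricSpace X]
    (γ : unitInterval → X) {P Q : Partition} (h : range P.t ⊆ range Q.t) :
    ∑ k : Fin P.n, edist (γ (P.t k.succ)) (γ (P.t k.castSucc)) ≤
      ∑ k : Fin Q.n, edist (γ (Q.t k.succ)) (γ (Q.t k.castSucc)) := by
  classical
  have hex : ∀ j, ∃ i, Q.t i = P.t j := fun j => h ⟨j, rfl⟩
  -- Partitions may repeat points; taking the least index keeps `σ` monotone across repetitions.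
  let σ : Fin (P.n + 1) → Fin (Q.n + 1) := fun j => Fin.find (fun i => Q.t i = P.t j) (hex j)
  have hσ : ∀ j, Q.t (σ j) = P.t j := fun j => Fin.find_spec (hex j)
  have hmono : Monotone σ := by
    intro j j' hjj'
    rcases (P.mono hjj').eq_or_lt with he | hlt
    · exact Fin.find_le_of_pos (hex j) (by simpa only [he] using hσ j')
    · by_contra hcon
      have h1 := Q.mono (not_le.1 hcon).le
      rw [hσ, hσ] at h1
      exact absurd h1 (not_le.2 hlt)
  have := sum_edist_comp_le (fun i => γ (Q.t i)) hmono
  simpa only [hσ] using this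

theorem Partition.exists_range_eq (S : Finset unitInterval) (h0 : 0 ∈ S) (h1 : 1 ∈ S) :
    ∃ P : Partition, range P.t = S := by
  have hpos : 0 < S.card := Finset.card_pos.2 ⟨0, h0⟩
  obtain ⟨n, hn⟩ : ∃ n, S.card = n + 1 := ⟨S.card - 1, by omega⟩
  have hr : range (S.orderEmbOfFin hn) = S := S.range_orderEmbOfFin hn
  refine ⟨⟨n, S.orderEmbOfFin hn, (S.orderEmbOfFin hn).monotone, ?_, ?_⟩, hr⟩
  · obtain ⟨i, hi⟩ : (0 : unitInterval) ∈ range (S.orderEmbOfFin hn) := by rw [hr]; exact h0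
    refine le_antisymm ?_ unitInterval.nonneg'
    rw [← hi]
    exact (S.orderEmbOfFin hn).monotone (Fin.zero_le i)
  · obtain ⟨i, hi⟩ : (1 : unitInterval) ∈ range (S.orderEmbOfFin hn) := by rw [hr]; exact h1
    refine le_antisymm unitInterval.le_one' ?_
    rw [← hi]
    exact (S.orderEmbOfFin hn).monotone (Fin.le_last i)

/-- The first grid point strictly after `a` is at most `a + 1 / N`, and the next partition point
cannot jump over it; if that grid point exceeds `1`, then `b ≤ 1` suffices. -/
theorem Partition.dist_le_of_forall_mem_range (P : Partition) {N : ℕ} (hN : 0 < N)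
    (h : ∀ s : unitInterval, (∃ j : ℕ, (s : ℝ) = j / N) → s ∈ range P.t) (k : Fin P.n) :
    dist (P.t k.succ) (P.t k.castSucc) ≤ 1 / N := by
  have hN' : (0 : ℝ) < N := by exact_mod_cast hN
  set a := P.t k.castSucc
  set b := P.t k.succ
  have hab : a ≤ b := P.mono (Fin.castSucc_lt_succ).le
  rw [Subtype.dist_eq, Real.dist_eq, abs_of_nonneg (sub_nonneg.2 (Subtype.coe_le_coe.2 hab))]
  let j := ⌊(a : ℝ) * N⌋₊
  have hj : (j : ℝ) ≤ a * N := Nat.floor_le (mul_nonneg a.2.1 hN'.le)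
  have hj' : (a : ℝ) * N < j + 1 := Nat.lt_floor_add_one _
  have hja : ((j + 1 : ℕ) : ℝ) / N ≤ a + 1 / N := by
    push_cast
    rw [add_div]
    gcongr
    rwa [div_le_iff₀ hN']
  by_cases hle : ((j + 1 : ℕ) : ℝ) / N ≤ 1
  · obtain ⟨i, hi⟩ := h ⟨_, by positivity, hle⟩ ⟨j + 1, rfl⟩
    have hai : a < P.t i := by
      rw [hi, ← Subtype.coe_lt_coe, lt_div_iff₀ hN']
      exact_mod_cast hj'
    have hki : k.castSucc < i := by
      by_contra hcon
      exact absurd (P.mono (not_lt.1 hcon)) (not_le.2 hai)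
    have hbi : b ≤ P.t i := P.mono (Fin.castSucc_lt_iff_succ_le.1 hki)
    rw [hi, ← Subtype.coe_le_coe] at hbi
    simp only at hbi
    linarith
  · have := b.2.2
    linarith

theorem Partition.exists_refinement {X : Type*} [PseudoMetricSpace X] (γ : unitInterval → X)
    (hγ : pathLength γ < ∞) {ε δ : ℝ} (hε : 0 < ε) (hδ : 0 < δ) :
    ∃ P₀ : Partition, ∀ P : Partition, range P₀.t ⊆ range P.t →
      |(pathLength γ).toReal - ∑ k : Fin P.n, dist (γ (P.t k.succ)) (γ (P.t k.castSucc))| ≤ ε ∧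
      ∀ k : Fin P.n, dist (P.t k.succ) (P.t k.castSucc) < δ := by
  classical
  let L : Partition → ℝ≥0∞ := fun P => ∑ k : Fin P.n, edist (γ (P.t k.succ)) (γ (P.t k.castSucc))
  have hLle : ∀ P, L P ≤ pathLength γ := fun P => le_iSup L P
  have hL : ∀ P, (L P).toReal = ∑ k : Fin P.n, dist (γ (P.t k.succ)) (γ (P.t k.castSucc)) := by
    intro P
    rw [ENNReal.toReal_sum fun k _ => edist_ne_top _ _]
    simp [edist_dist]
  obtain ⟨P₁, hP₁⟩ : ∃ P, pathLength γ ≤ L P + ENNReal.ofReal ε := by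
    by_cases h0 : pathLength γ = 0
    · obtain ⟨P, -⟩ := Partition.exists_range_eq {0, 1} (by simp) (by simp)
      exact ⟨P, by simp [h0]⟩
    · have h1 : pathLength γ - ENNReal.ofReal ε < ⨆ P, L P :=
        ENNReal.sub_lt_self hγ.ne h0 (by simpa using hε)
      obtain ⟨P, hP⟩ := lt_iSup_iff.1 h1
      exact ⟨P, tsub_le_iff_right.1 hP.le⟩
  obtain ⟨N, hN⟩ := exists_nat_one_div_lt hδ
  let q : ℕ → unitInterval := fun j => projIcc 0 1 zero_le_one ((j : ℝ) / (N + 1 : ℕ))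
  -- A nearly optimal partition merged with a grid of step `1 / (N + 1)`: refinements are then both
  -- nearly optimal and fine.
  let S : Finset unitInterval := Finset.univ.image P₁.t ∪ (Finset.range (N + 2)).image q
  have hP₁S : ∀ i, P₁.t i ∈ S := fun i =>
    Finset.mem_union_left _ (Finset.mem_image_of_mem _ (Finset.mem_univ i))
  obtain ⟨P₀, hP₀⟩ := Partition.exists_range_eq S (P₁.first ▸ hP₁S 0) (P₁.last ▸ hP₁S _)
  refine ⟨P₀, fun P hP => ⟨?_, fun k => ?_⟩⟩
  · have h1 : L P₁ ≤ L P := Partition.sum_edist_le_of_range_subset γ (by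
      refine Subset.trans ?_ hP
      rw [hP₀]
      rintro _ ⟨i, rfl⟩
      exact hP₁S i)
    have h2 : L P ≠ ∞ := ((hLle P).trans_lt hγ).ne
    have h3 : (L P).toReal ≤ (pathLength γ).toReal := ENNReal.toReal_mono hγ.ne (hLle P)
    have h4 : (pathLength γ).toReal ≤ (L P).toReal + ε := by
      have := ENNReal.toReal_mono (by finiteness)
        (hP₁.trans (add_le_add_left h1 (ENNReal.ofReal ε)))
      rwa [ENNReal.toReal_add h2 ENNReal.ofReal_ne_top, ENNReal.toReal_ofReal hε.le] at this
    rw [← hL, abs_le]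
    constructor <;> linarith
  · refine (P.dist_le_of_forall_mem_range (Nat.succ_pos N) ?_ k).trans_lt (by simpa using hN)
    rintro s ⟨j, hj⟩
    refine hP ?_
    rw [hP₀]
    have hj1 : (j : ℝ) / (N + 1 : ℕ) ≤ 1 := by
      have := s.2.2
      rwa [hj] at this
    refine Finset.mem_union_right _ (Finset.mem_image.2 ⟨j, Finset.mem_range.2 ?_, ?_⟩)
    · rw [div_le_one (by positivity)] at hj1
      have : j ≤ N + 1 := by exact_mod_cast hj1
      omega
    · refine Subtype.ext ?_
      simp only [q]
      rw [projIcc_of_mem _ ⟨by positivity, hj1⟩, hj]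

theorem pathLength_comp_le {X Y : Type*} [PseudoEMetricSpace X] [PseudoEMetricSpace Y] {K : ℝ≥0}
    {h : X → Y} (hh : LipschitzWith K h) (γ : unitInterval → X) :
    pathLength (fun t => h (γ t)) ≤ K * pathLength γ := by
  refine iSup_le fun P => ?_
  refine le_trans ?_ (mul_le_mul_right (le_iSup (fun P : Partition => ∑ k : Fin P.n,
    edist (γ (P.t k.succ)) (γ (P.t k.castSucc))) P) _)
  rw [Finset.mul_sum]
  exact Finset.sum_le_sum fun k _ => hh _ _

theorem sum_dist_le_pathLength {X : Type*} [PseudoMetricSpace X] {γ : unitInterval → X}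
    (hγ : pathLength γ < ∞) (P : Partition) :
    ∑ k : Fin P.n, dist (γ (P.t k.succ)) (γ (P.t k.castSucc)) ≤ (pathLength γ).toReal := by
  have h := ENNReal.toReal_mono hγ.ne (le_iSup (fun P : Partition => ∑ k : Fin P.n,
    edist (γ (P.t k.succ)) (γ (P.t k.castSucc))) P)
  rw [ENNReal.toReal_sum fun k _ => edist_ne_top _ _] at h
  simpa [edist_dist] using h

/-- The length of a `C¹` curve is the integral of its speed. -/
theorem pathLength_toReal_eq_integral {E : Type*} [NormedAddCommGroup E] [NormedSpace ℝ E]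
    {g : ℝ → E} (hg : ContDiffOn ℝ 1 g (Icc 0 1))
    (hl : pathLength (fun t : unitInterval => g t) < ∞) :
    (pathLength fun t : unitInterval => g t).toReal =
      ∫ t in (0 : ℝ)..1, ‖derivWithin g (Icc 0 1) t‖ := by
  set v := derivWithin g (Icc 0 1) with hv
  have hvc : ContinuousOn v (Icc 0 1) :=
    hg.continuousOn_derivWithin (uniqueDiffOn_Icc zero_lt_one) le_rfl
  have hgd : ∀ t ∈ Icc (0 : ℝ) 1, HasDerivWithinAt g (v t) (Icc 0 1) t := fun t ht =>
    (hg.differentiableOn (by norm_num) t ht).hasDerivWithinAt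
  have hint : ∀ a ∈ Icc (0 : ℝ) 1, ∀ b ∈ Icc (0 : ℝ) 1,
      IntervalIntegrable (fun t => ‖v t‖) volume a b := fun a ha b hb =>
    (hvc.norm.mono (by
      intro t ht
      exact (ordConnected_Icc.uIcc_subset ha hb) ht)).intervalIntegrable
  let F : unitInterval → ℝ := fun t => ∫ s in (0 : ℝ)..t, ‖v s‖
  -- Both increments are compared with `(t - s) * ‖v s‖`, each costing half of `ε`. The errors then
  -- add up over a partition to at most `ε` times total time `1`.
  have hloc : ∀ ε > 0, ∃ δ > 0, ∀ s t : unitInterval, s ≤ t → dist t s < δ →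
      |dist (g t) (g s) - (F t - F s)| ≤ ε * ((t : ℝ) - s) := by
    intro ε hε
    obtain ⟨δ, hδ, hvu⟩ := Metric.uniformContinuousOn_iff.1
      (isCompact_Icc.uniformContinuousOn_of_continuous hvc) (ε / 2) (by positivity)
    refine ⟨δ, hδ, fun s t hst hdist => ?_⟩
    have hst' : (s : ℝ) ≤ t := hst
    have hsub : Icc (s : ℝ) t ⊆ Icc 0 1 := Icc_subset_Icc s.2.1 t.2.2
    have hclose : ∀ τ ∈ Icc (s : ℝ) t, ‖v τ - v s‖ ≤ ε / 2 := fun τ hτ => by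
      rw [← dist_eq_norm]
      refine (hvu τ (hsub hτ) s s.2 ?_).le
      rw [Subtype.dist_eq, Real.dist_eq, abs_of_nonneg (sub_nonneg.2 hst')] at hdist
      rw [Real.dist_eq, abs_of_nonneg (sub_nonneg.2 hτ.1)]
      linarith [hτ.2]
    have h1 : ‖g t - g s - ((t : ℝ) - s) • v s‖ ≤ ε / 2 * ((t : ℝ) - s) := by
      have h := (convex_Icc (s : ℝ) t).norm_image_sub_le_of_norm_hasDerivWithin_le
        (f := fun τ => g τ - τ • v s) (f' := fun τ => v τ - v s)
        (fun τ hτ => ((hgd τ (hsub hτ)).mono hsub).sub (by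
          simpa using (hasDerivWithinAt_id τ (Icc (s : ℝ) t)).smul_const (v s)))
        hclose (left_mem_Icc.2 hst') (right_mem_Icc.2 hst')
      rw [Real.norm_eq_abs, abs_of_nonneg (sub_nonneg.2 hst')] at h
      refine le_trans (le_of_eq ?_) h
      congr 1
      rw [sub_smul]; abel
    have h2 : |F t - F s - ((t : ℝ) - s) * ‖v s‖| ≤ ε / 2 * ((t : ℝ) - s) := by
      have hFt : F t - F s - ((t : ℝ) - s) * ‖v s‖ = ∫ τ in (s : ℝ)..t, (‖v τ‖ - ‖v s‖) := by
        rw [intervalIntegral.integral_sub (hint s s.2 t t.2) (by simp),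
          intervalIntegral.integral_const, smul_eq_mul]
        simp only [F]
        rw [intervalIntegral.integral_interval_sub_left (hint 0 (by simp) t t.2)
          (hint 0 (by simp) s s.2)]
      rw [hFt, ← Real.norm_eq_abs]
      refine (intervalIntegral.norm_integral_le_of_norm_le_const (C := ε / 2) ?_).trans_eq ?_
      · intro τ hτ
        rw [uIoc_of_le hst'] at hτ
        exact (abs_norm_sub_norm_le _ _).trans (hclose τ (Ioc_subset_Icc_self hτ))
      · rw [abs_of_nonneg (sub_nonneg.2 hst')]
    have h3 : |dist (g t) (g s) - ((t : ℝ) - s) * ‖v s‖| ≤ ε / 2 * ((t : ℝ) - s) := by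
      refine le_trans ?_ h1
      have h4 : ((t : ℝ) - s) * ‖v s‖ = ‖((t : ℝ) - s) • v s‖ := by
        rw [norm_smul, Real.norm_eq_abs, abs_of_nonneg (sub_nonneg.2 hst')]
      rw [h4, dist_eq_norm]
      exact abs_norm_sub_norm_le _ _
    rw [abs_le] at h2 h3 ⊢
    constructor <;> linarith
  have hF1 : F 1 - F 0 = ∫ t in (0 : ℝ)..1, ‖v t‖ := by simp [F]
  rw [← hF1]
  refine eq_of_abs_sub_le_all fun ε hε => ?_
  obtain ⟨δ, hδ, hδ'⟩ := hloc (ε / 2) (by positivity)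
  obtain ⟨P, hP⟩ := Partition.exists_refinement _ hl (half_pos hε) hδ
  obtain ⟨h1, h2⟩ := hP P Subset.rfl
  have h3 : |∑ k : Fin P.n, dist (g (P.t k.succ)) (g (P.t k.castSucc)) - (F 1 - F 0)| ≤ ε / 2 := by
    rw [← P.first, ← P.last, ← sum_fin_succ_sub_castSucc fun k => F (P.t k),
      ← Finset.sum_sub_distrib]
    refine (Finset.abs_sum_le_sum_abs _ _).trans ?_
    refine (Finset.sum_le_sum fun k _ =>
      hδ' _ _ (P.mono (Fin.castSucc_lt_succ (i := k)).le) (h2 k)).trans ?_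
    rw [← Finset.mul_sum, sum_fin_succ_sub_castSucc fun k => (P.t k : ℝ), P.first, P.last]
    simp
  rw [abs_le] at h1 h3 ⊢
  constructor <;> linarith

/-! ### The Riemannian metric and the bi-Lipschitz feature map -/

section Ball

variable {d : ℕ} {r : ℝ} {f : EuclideanSpace ℝ (Fin d) → EuclideanSpace ℝ (Fin d) → ℝ}

local notation "𝔼" => EuclideanSpace ℝ (Fin d)

theorem continuous_metricNorm (z : 𝔼) : Continuous (metricNorm r f z) := by
  have h : Continuous (Matrix.toEuclideanLin (mixedHessian r f z)) :=
    LinearMap.continuous_of_finiteDimensional _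
  unfold metricNorm
  fun_prop

theorem metricNorm_smul (z : 𝔼) (c : ℝ) (v : 𝔼) :
    metricNorm r f z (c • v) = |c| * metricNorm r f z v := by
  unfold metricNorm
  rw [map_smul, inner_smul_left, inner_smul_right, RCLike.conj_to_real, ← mul_assoc,
    Real.sqrt_mul (mul_self_nonneg c), Real.sqrt_mul_self_eq_abs]

theorem inner_toEuclideanLin_pos {M : Matrix (Fin d) (Fin d) ℝ} (hM : M.PosDef) {v : 𝔼}
    (hv : v ≠ 0) : 0 < inner ℝ v (Matrix.toEuclideanLin M v) := by
  have h := hM.dotProduct_mulVec_pos (x := v.ofLp) fun h => hv (by ext i; exact congrFun h i)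
  rw [PiLp.inner_apply]
  simpa [Matrix.toLpLin_apply, dotProduct, mul_comm] using h

theorem sq_metricNorm {z : 𝔼} (hM : (mixedHessian r f z).PosDef) (v : 𝔼) :
    metricNorm r f z v ^ 2 = inner ℝ v (Matrix.toEuclideanLin (mixedHessian r f z) v) := by
  refine Real.sq_sqrt ?_
  rcases eq_or_ne v 0 with rfl | hv
  · simp
  · exact (inner_toEuclideanLin_pos hM hv).le

/-- The metric is uniformly comparable to the Euclidean one on a compact set. -/
theorem exists_sq_metricNorm_bounds (hr : 0 < r)
    (hC2 : ContDiffOn ℝ 2 (fun p : 𝔼 × 𝔼 => f p.1 p.2) (closedBall 0 r ×ˢ closedBall 0 r))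
    {Z : Set 𝔼} (hZ : IsCompact Z) (hZr : Z ⊆ closedBall 0 r)
    (hpos : ∀ z ∈ Z, (mixedHessian r f z).PosDef) :
    ∃ c > 0, ∃ C : ℝ, ∀ z ∈ Z, ∀ v,
      c * ‖v‖ ^ 2 ≤ metricNorm r f z v ^ 2 ∧ metricNorm r f z v ^ 2 ≤ C * ‖v‖ ^ 2 := by
  have hmc : ContinuousOn (mixedDeriv r f) Z := (continuousOn_mixedDeriv hr hC2).mono hZr
  -- By homogeneity it is enough to bound the form on unit vectors.
  have hK : IsCompact (Z ×ˢ sphere (0 : 𝔼) 1) := hZ.prod (isCompact_sphere _ _)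
  have hq : ContinuousOn (fun p : 𝔼 × 𝔼 => mixedDeriv r f p.1 (p.2, 0) (0, p.2))
      (Z ×ˢ sphere 0 1) := by
    have : ContinuousOn (fun p : 𝔼 × 𝔼 => mixedDeriv r f p.1) (Z ×ˢ sphere 0 1) :=
      hmc.comp continuousOn_fst fun p hp => hp.1
    fun_prop
  have hQ : ∀ z ∈ Z, ∀ v, metricNorm r f z v ^ 2 = mixedDeriv r f z (v, 0) (0, v) :=
    fun z hz v => by rw [sq_metricNorm (hpos z hz), inner_mixedHessian hr hC2 (hZr hz)]
  obtain ⟨c, hc, hcq⟩ := hK.exists_forall_le' hq (a := 0) fun p hp => by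
    rw [← inner_mixedHessian hr hC2 (hZr hp.1)]
    refine inner_toEuclideanLin_pos (hpos _ hp.1) fun h => ?_
    have := hp.2
    simp [h] at this
  obtain ⟨C, hC⟩ := (hK.image_of_continuousOn hq).bddAbove
  refine ⟨c, hc, C, fun z hz v => ?_⟩
  rcases eq_or_ne v 0 with rfl | hv
  · simp [metricNorm]
  have hv' : ‖v‖ ≠ 0 := norm_ne_zero_iff.2 hv
  have hw : ‖v‖⁻¹ • v ∈ sphere (0 : 𝔼) 1 := by simp [norm_smul, hv']
  have h1 : metricNorm r f z v ^ 2 = metricNorm r f z (‖v‖⁻¹ • v) ^ 2 * ‖v‖ ^ 2 := by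
    rw [metricNorm_smul, abs_of_nonneg (by positivity)]
    field_simp
  rw [h1, hQ z hz (‖v‖⁻¹ • v)]
  exact ⟨mul_le_mul_of_nonneg_right (hcq (z, ‖v‖⁻¹ • v) ⟨hz, hw⟩) (sq_nonneg _),
    mul_le_mul_of_nonneg_right (hC ⟨(z, ‖v‖⁻¹ • v), ⟨hz, hw⟩, rfl⟩) (sq_nonneg _)⟩

variable {Z : Set (EuclideanSpace ℝ (Fin d))}

theorem MercerExpansion.inner_featureMap (m : MercerExpansion r f) (hZr : Z ⊆ closedBall 0 r)
    (x y : Z) : inner ℝ (m.featureMap hZr x) (m.featureMap hZr y) = f x y := by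
  have hs := (m.summable_abs x (hZr x.2) y (hZr y.2)).of_abs.hasSum.tendsto_sum_nat
  have ht := m.tendstoUniformlyOn.tendsto_at (x := ((x : 𝔼), (y : 𝔼))) ⟨hZr x.2, hZr y.2⟩
  rw [← tendsto_nhds_unique hs ht, lp.inner_eq_tsum]
  refine tsum_congr fun k => ?_
  have h := Real.mul_self_sqrt (m.eigval_nonneg k)
  simp only [MercerExpansion.featureMap, RCLike.inner_apply, conj_trivial]
  linear_combination (m.eigfun k x * m.eigfun k y) * h

theorem MercerExpansion.sq_dist_featureMap (m : MercerExpansion r f)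
    (hZr : Z ⊆ closedBall 0 r) (x y : Z) :
    dist (m.featureMap hZr x) (m.featureMap hZr y) ^ 2 = f x x - f x y - f y x + f y y := by
  rw [dist_eq_norm, norm_sub_sq_real, ← real_inner_self_eq_norm_sq, ← real_inner_self_eq_norm_sq,
    m.inner_featureMap, m.inner_featureMap, m.inner_featureMap, ← m.inner_featureMap hZr y x,
    real_inner_comm, m.inner_featureMap]
  ring

/-- `f x a` is the inner product of the features of `x` and `a`, so equal features cannot be
separated by any `a`. -/
theorem MercerExpansion.injective_featureMap (m : MercerExpansion r f)
    (hZr : Z ⊆ closedBall 0 r) (hinj : ∀ x ∈ Z, ∀ y ∈ Z, x ≠ y → ∃ a ∈ Z, f x a ≠ f y a) :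
    Function.Injective (m.featureMap hZr) := by
  intro x y h
  by_contra hxy
  obtain ⟨a, ha, hne⟩ := hinj x x.2 y y.2 fun h => hxy (Subtype.ext h)
  apply hne
  rw [← m.inner_featureMap hZr x ⟨a, ha⟩, h, m.inner_featureMap]

/-- For nonnegative reals `(a - b)² ≤ |a² - b²|`. This passes from squared lengths to lengths
without dividing. -/
theorem abs_sub_le_mul_of_abs_sq_sub_sq_le {a b e t : ℝ} (ha : 0 ≤ a) (hb : 0 ≤ b) (he : 0 ≤ e)
    (ht : 0 ≤ t) (h : |a ^ 2 - b ^ 2| ≤ e ^ 2 * t ^ 2) : |a - b| ≤ e * t := by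
  refine abs_le_of_sq_le_sq ?_ (by positivity)
  rw [abs_le] at h
  rcases le_total a b with hab | hab <;>
    nlinarith [mul_nonneg ha (sub_nonneg.2 hab), mul_nonneg hb (sub_nonneg.2 hab)]

/-- The chordal distance in feature space agrees with the Riemannian length element to first order,
uniformly. -/
theorem MercerExpansion.exists_abs_dist_sub_metricNorm_le (m : MercerExpansion r f) (hr : 0 < r)
    (hZr : Z ⊆ closedBall 0 r)
    (hC2 : ContDiffOn ℝ 2 (fun p : 𝔼 × 𝔼 => f p.1 p.2) (closedBall 0 r ×ˢ closedBall 0 r))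
    (hpos : ∀ z ∈ Z, (mixedHessian r f z).PosDef) {ε : ℝ} (hε : 0 < ε) :
    ∃ δ > 0, ∀ x y : Z, dist x y < δ →
      |dist (m.featureMap hZr x) (m.featureMap hZr y) - metricNorm r f y ((x : 𝔼) - y)|
        ≤ ε * dist x y := by
  obtain ⟨δ, hδ, h⟩ := exists_abs_second_difference_sub_le (isCompact_closedBall (0 : 𝔼) r)
    (convex_closedBall _ _) ⟨0, ball_subset_interior_closedBall (mem_ball_self hr)⟩ hC2
    (show 0 < ε ^ 2 by positivity)
  refine ⟨δ, hδ, fun x y hxy => ?_⟩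
  refine abs_sub_le_mul_of_abs_sq_sub_sq_le dist_nonneg (Real.sqrt_nonneg _) hε.le dist_nonneg ?_
  rw [m.sq_dist_featureMap, sq_metricNorm (hpos y y.2), inner_mixedHessian hr hC2 (hZr y.2),
    Subtype.dist_eq, dist_eq_norm]
  exact h x (hZr x.2) y (hZr y.2) hxy

theorem MercerExpansion.exists_dist_featureMap_bounds (m : MercerExpansion r f) (hr : 0 < r)
    (hZ : IsCompact Z) (hZr : Z ⊆ closedBall 0 r) (hf : IsKernelOn r f)
    (hinj : ∀ x ∈ Z, ∀ y ∈ Z, x ≠ y → ∃ a ∈ Z, f x a ≠ f y a)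
    (hC2 : ContDiffOn ℝ 2 (fun p : 𝔼 × 𝔼 => f p.1 p.2) (closedBall 0 r ×ˢ closedBall 0 r))
    (hpos : ∀ z ∈ Z, (mixedHessian r f z).PosDef) :
    ∃ K K' : ℝ≥0, ∀ x y : Z,
      dist (m.featureMap hZr x) (m.featureMap hZr y) ≤ K * dist x y ∧
      dist x y ≤ K' * dist (m.featureMap hZr x) (m.featureMap hZr y) := by
  obtain ⟨c, hc, C, hcC⟩ := exists_sq_metricNorm_bounds hr hC2 hZ hZr hpos
  obtain ⟨δ, hδ, hloc⟩ := exists_abs_second_difference_sub_le (isCompact_closedBall (0 : 𝔼) r)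
    (convex_closedBall _ _) ⟨0, ball_subset_interior_closedBall (mem_ball_self hr)⟩ hC2
    -- An error of `c / 2` leaves half of the lower bound `c` near the diagonal.
    (half_pos hc)
  have hDc : ContinuousOn (fun p : 𝔼 × 𝔼 => f p.1 p.1 - f p.1 p.2 - f p.2 p.1 + f p.2 p.2)
      (Z ×ˢ Z) := by
    have h := hf.continuousOn.mono (prod_mono hZr hZr)
    have h1 := h.comp (f := fun p : 𝔼 × 𝔼 => (p.1, p.1)) (s := Z ×ˢ Z) (by fun_prop)
      fun p hp => ⟨hp.1, hp.1⟩
    have h2 := h.comp (f := fun p : 𝔼 × 𝔼 => (p.2, p.1)) (s := Z ×ˢ Z) (by fun_prop)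
      fun p hp => ⟨hp.2, hp.1⟩
    have h3 := h.comp (f := fun p : 𝔼 × 𝔼 => (p.2, p.2)) (s := Z ×ˢ Z) (by fun_prop)
      fun p hp => ⟨hp.2, hp.2⟩
    exact ((h1.sub h).sub h2).add h3
  obtain ⟨c', hc', C', hC', h⟩ := exists_sq_dist_bounds hZ hDc (fun x hx y hy hxy => by
      have h1 := m.sq_dist_featureMap hZr ⟨x, hx⟩ ⟨y, hy⟩
      simp only at h1 ⊢
      rw [← h1]
      have : m.featureMap hZr ⟨x, hx⟩ ≠ m.featureMap hZr ⟨y, hy⟩ := fun h =>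
        hxy (congrArg Subtype.val (m.injective_featureMap hZr hinj h))
      have := dist_pos.2 this
      positivity) hδ (half_pos hc) (C := C + c / 2) fun x hx y hy hxy => by
    have h1 := hloc x (hZr hx) y (hZr hy) hxy
    obtain ⟨h2, h3⟩ := hcC y hy (x - y)
    rw [sq_metricNorm (hpos y hy), inner_mixedHessian hr hC2 (hZr hy)] at h2 h3
    rw [abs_le] at h1
    rw [dist_eq_norm]
    unfold mixedDeriv at h2 h3
    constructor <;> linarith [h1.1, h1.2]
  refine ⟨(√C').toNNReal, (√c')⁻¹.toNNReal, fun x y => ?_⟩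
  obtain ⟨h1, h2⟩ := h x x.2 y y.2
  simp only at h1 h2
  rw [← m.sq_dist_featureMap hZr, ← Subtype.dist_eq] at h1 h2
  rw [Real.coe_toNNReal _ (Real.sqrt_nonneg _), Real.coe_toNNReal _ (by positivity)]
  constructor
  · refine le_of_sq_le_sq ?_ (by positivity)
    rwa [mul_pow, Real.sq_sqrt hC']
  · rw [inv_mul_eq_div, le_div_iff₀ (Real.sqrt_pos.2 hc')]
    refine le_of_sq_le_sq ?_ (by positivity)
    rw [mul_pow, Real.sq_sqrt hc'.le]
    linarith

end Ball

/-! ### Lengths from first-order agreement -/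

section Length

variable {E F : Type*} [NormedAddCommGroup E]

/-- Riemann sums of a length element that matches the distance of `Y` to first order converge to
the length of a rectifiable curve. -/
theorem exists_partition_abs_pathLength_sub_sum_le {Y : Type*} [PseudoMetricSpace Y] {Z : Set E}
    {φ : Z → Y} {N : E → E → ℝ}
    (hφ : ∀ ε > 0, ∃ δ > 0, ∀ x y : Z, dist x y < δ →
      |dist (φ x) (φ y) - N y ((x : E) - y)| ≤ ε * dist x y)
    {η : unitInterval → Z} (hη : Continuous η) (hηl : pathLength η < ∞)
    (hl : pathLength (fun t => φ (η t)) < ∞) {ε : ℝ} (hε : 0 < ε) :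
    ∃ P₀ : Partition, ∀ P : Partition, range P₀.t ⊆ range P.t →
      |(pathLength fun t => φ (η t)).toReal -
        ∑ k : Fin P.n, N (η (P.t k.castSucc)) ((η (P.t k.succ) : E) - η (P.t k.castSucc))| ≤ ε := by
  set l := (pathLength η).toReal
  have hl0 : 0 ≤ l := ENNReal.toReal_nonneg
  -- The local errors sum to at most this tolerance times `l`, hence to `ε / 2`; the `+ 1` covers `l
  -- = 0`.
  obtain ⟨δ, hδ, hφδ⟩ := hφ (ε / 2 / (l + 1)) (by positivity)
  obtain ⟨δ', hδ', hηδ⟩ := Metric.uniformContinuous_iff.1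
    (CompactSpace.uniformContinuous_of_continuous hη) δ hδ
  obtain ⟨P₀, hP₀⟩ := Partition.exists_refinement _ hl (half_pos hε) hδ'
  refine ⟨P₀, fun P hP => ?_⟩
  obtain ⟨h1, h2⟩ := hP₀ P hP
  have h3 : |∑ k : Fin P.n, dist (φ (η (P.t k.succ))) (φ (η (P.t k.castSucc))) -
      ∑ k : Fin P.n, N (η (P.t k.castSucc)) ((η (P.t k.succ) : E) - η (P.t k.castSucc))|
      ≤ ε / 2 := by
    rw [← Finset.sum_sub_distrib]
    refine (Finset.abs_sum_le_sum_abs _ _).trans ?_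
    refine (Finset.sum_le_sum fun k _ => hφδ _ _ (hηδ (h2 k))).trans ?_
    rw [← Finset.mul_sum]
    refine (mul_le_mul_of_nonneg_left (sum_dist_le_pathLength hηl P) (by positivity)).trans ?_
    rw [div_mul_eq_mul_div, div_le_iff₀ (by positivity)]
    exact mul_le_mul_of_nonneg_left (by linarith) (by positivity)
  rw [abs_le] at h1 h3 ⊢
  constructor <;> linarith

/-- If a length element matches the distance to first order then it computes the speed of a
differentiable curve. -/
theorem norm_eq_of_hasDerivWithinAt [NormedSpace ℝ E] [NormedAddCommGroup F] [NormedSpace ℝ F]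
    {s : Set ℝ} {t : ℝ}
    (ht : t ∈ s) (hs : UniqueDiffWithinAt ℝ s t) {Z : Set E} {φ : Z → F} {N : E → E → ℝ}
    (hN : ∀ z, Continuous (N z)) (hNs : ∀ z (c : ℝ) v, N z (c • v) = |c| * N z v)
    (hφ : ∀ ε > 0, ∃ δ > 0, ∀ x y : Z, dist x y < δ →
      |dist (φ x) (φ y) - N y ((x : E) - y)| ≤ ε * dist x y)
    {g : ℝ → F} {h : ℝ → E} {η : ℝ → Z} (hh : ∀ τ ∈ s, h τ = η τ) (hg : ∀ τ ∈ s, g τ = φ (η τ))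
    {g' : F} {h' : E} (hg' : HasDerivWithinAt g g' s t) (hh' : HasDerivWithinAt h h' s t) :
    ‖g'‖ = N (η t) h' := by
  have : (𝓝[s \ {t}] t).NeBot :=
    accPt_principal_iff_nhdsWithin.1 (uniqueDiffWithinAt_iff_accPt.1 hs)
  have hgs := (hasDerivWithinAt_iff_tendsto_slope.1 hg').norm
  have hhs := hasDerivWithinAt_iff_tendsto_slope.1 hh'
  have hNh := ((hN (η t)).tendsto h').comp hhs
  -- Homogeneity of `N` scales the first-order comparison to difference quotients, and `τ → t` gives
  -- the bound.
  have key : ∀ ε > 0, |‖g'‖ - N (η t) h'| ≤ ε * ‖h'‖ := by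
    intro ε hε
    obtain ⟨δ, hδ, hφδ⟩ := hφ ε hε
    refine le_of_tendsto_of_tendsto (hgs.sub hNh).abs (hhs.norm.const_mul ε) ?_
    have hclose : ∀ᶠ τ in 𝓝[s \ {t}] t, dist (h τ) (h t) < δ :=
      Metric.tendsto_nhds.1 (hh'.continuousWithinAt.mono sdiff_subset) δ hδ
    filter_upwards [hclose, self_mem_nhdsWithin] with τ hτ hτs
    have hτs : τ ∈ s := hτs.1
    rw [hh τ hτs, hh t ht] at hτ
    have h1 := hφδ (η τ) (η t) hτ
    simp only [Function.comp, slope_def_module]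
    rw [norm_smul, hNs, norm_smul, hh τ hτs, hh t ht, hg τ hτs, hg t ht, Real.norm_eq_abs,
      ← mul_sub, abs_mul, abs_abs, ← dist_eq_norm, ← dist_eq_norm, mul_left_comm]
    exact mul_le_mul_of_nonneg_left h1 (abs_nonneg _)
  refine eq_of_abs_sub_le_all fun ε hε => ?_
  refine (key (ε / (‖h'‖ + 1)) (by positivity)).trans ?_
  rw [div_mul_eq_mul_div, div_le_iff₀ (by positivity)]
  exact mul_le_mul_of_nonneg_left (by linarith) hε.le

end Length

end KernelGeometry

/-! ### The main theorem -/

theorem theorem1 {d : ℕ} (hd : 1 ≤ d) {r : ℝ} (hr : 0 < r)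
    (Z : Set (EuclideanSpace ℝ (Fin d))) (hZ : IsCompact Z) (hZr : Z ⊆ closedBall 0 r)
    (f : EuclideanSpace ℝ (Fin d) → EuclideanSpace ℝ (Fin d) → ℝ)
    (hf : KernelGeometry.IsKernelOn r f)
    (hinj : ∀ x ∈ Z, ∀ y ∈ Z, x ≠ y → ∃ a ∈ Z, f x a ≠ f y a)
    (hC2 : ContDiffOn ℝ 2
      (fun p : EuclideanSpace ℝ (Fin d) × EuclideanSpace ℝ (Fin d) => f p.1 p.2)
      (closedBall 0 r ×ˢ closedBall 0 r))
    (hpos : ∀ z ∈ Z, (KernelGeometry.mixedHessian r f z).PosDef) :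
    -- a Mercer expansion exists, and the result holds for the feature map of each of them
    Nonempty (KernelGeometry.MercerExpansion r f) ∧
    ∀ m : KernelGeometry.MercerExpansion r f,
      -- `φ` is a bi-Lipschitz homeomorphism `e` from `Z` onto its image
      ∃ e : Z ≃ₜ range (m.featureMap hZr),
        (∀ z, (e z : KernelGeometry.EllTwo) = m.featureMap hZr z) ∧
        (∃ K : ℝ≥0, LipschitzWith K e) ∧
        (∃ K : ℝ≥0, LipschitzWith K e.symm) ∧
        -- every path of finite length in the image
        ∀ (a b : range (m.featureMap hZr)) (γ : Path a b),
          KernelGeometry.pathLength γ < ∞ →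
          -- the pulled-back curve is a path `η` in `Z`
          ∃ η : Path (e.symm a) (e.symm b), (∀ t, η t = e.symm (γ t)) ∧
            KernelGeometry.pathLength η < ∞ ∧
            (∀ ε : ℝ, 0 < ε → ∃ P₀ : KernelGeometry.Partition,
              ∀ P : KernelGeometry.Partition, range P₀.t ⊆ range P.t →
                |(KernelGeometry.pathLength γ).toReal -
                  ∑ k : Fin P.n, KernelGeometry.metricNorm r f (η (P.t k.castSucc))
                    ((η (P.t k.succ) : EuclideanSpace ℝ (Fin d)) - η (P.t k.castSucc))| ≤ ε) ∧
            (ContDiffOn ℝ 1 (fun t : ℝ => (γ.extend t : KernelGeometry.EllTwo)) (Icc 0 1) →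
              ContDiffOn ℝ 1 (fun t : ℝ => (η.extend t : EuclideanSpace ℝ (Fin d))) (Icc 0 1) →
              (KernelGeometry.pathLength γ).toReal =
                ∫ t in (0 : ℝ)..1,
                  ‖derivWithin (fun t : ℝ => (γ.extend t : KernelGeometry.EllTwo)) (Icc 0 1) t‖ ∧
              (KernelGeometry.pathLength γ).toReal =
                ∫ t in (0 : ℝ)..1, KernelGeometry.metricNorm r f (η.extend t)
                  (derivWithin (fun t : ℝ => (η.extend t : EuclideanSpace ℝ (Fin d)))
                    (Icc 0 1) t)) := by
  refine ⟨KernelGeometry.nonempty_mercerExpansion hd hr hf, fun m => ?_⟩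
  obtain ⟨K, K', hK⟩ := m.exists_dist_featureMap_bounds hr hZ hZr hf hinj hC2 hpos
  let E := Equiv.ofInjective (m.featureMap hZr) (m.injective_featureMap hZr hinj)
  have hE : ∀ z, (E z : KernelGeometry.EllTwo) = m.featureMap hZr z := fun z => rfl
  have hL : LipschitzWith K E := LipschitzWith.of_dist_le_mul fun x y => (hK x y).1
  have hL' : LipschitzWith K' E.symm := LipschitzWith.of_dist_le_mul fun x y => by
    have h := (hK (E.symm x) (E.symm y)).2
    rwa [← hE, ← hE, E.apply_symm_apply, E.apply_symm_apply, ← Subtype.dist_eq] at h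
  let e : Z ≃ₜ range (m.featureMap hZr) := ⟨E, hL.continuous, hL'.continuous⟩
  have he : ∀ z, (e z : KernelGeometry.EllTwo) = m.featureMap hZr z := hE
  refine ⟨e, he, ⟨K, hL⟩, ⟨K', hL'⟩, fun a b γ hγ => ?_⟩
  let η : Path (e.symm a) (e.symm b) := γ.map e.symm.continuous
  have hη : ∀ t, η t = e.symm (γ t) := fun t => rfl
  have hγη : ∀ t, (γ t : KernelGeometry.EllTwo) = m.featureMap hZr (η t) := fun t => by
    rw [hη, ← he, e.apply_symm_apply]
  have hlη : KernelGeometry.pathLength η < ∞ :=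
    (KernelGeometry.pathLength_comp_le hL' γ).trans_lt
      (ENNReal.mul_lt_top ENNReal.coe_lt_top hγ)
  have hlen : KernelGeometry.pathLength γ =
      KernelGeometry.pathLength fun t => m.featureMap hZr (η t) := by
    simp only [KernelGeometry.pathLength, ← hγη]
    rfl
  have hloc := fun (ε : ℝ) (hε : ε > 0) =>
    m.exists_abs_dist_sub_metricNorm_le hr hZr hC2 hpos hε
  refine ⟨η, hη, hlη, fun ε hε => ?_, fun hγC hηC => ?_⟩
  · rw [hlen] at hγ ⊢
    exact KernelGeometry.exists_partition_abs_pathLength_sub_sum_le hloc η.continuous hlη hγ hε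
  · have hlen' : KernelGeometry.pathLength γ = KernelGeometry.pathLength
        fun t : unitInterval => (γ.extend t : KernelGeometry.EllTwo) := by
      simp only [Path.extend_extends']
      rfl
    have h1 := KernelGeometry.pathLength_toReal_eq_integral hγC (hlen' ▸ hγ)
    rw [← hlen'] at h1
    refine ⟨h1, h1.trans (intervalIntegral.integral_congr fun t ht => ?_)⟩
    rw [uIcc_of_le zero_le_one] at ht
    exact KernelGeometry.norm_eq_of_hasDerivWithinAt ht (uniqueDiffOn_Icc zero_lt_one t ht)
      KernelGeometry.continuous_metricNorm KernelGeometry.metricNorm_smul hloc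
      (fun τ _ => rfl)
      (fun τ hτ => by rw [Path.extend_apply γ hτ, Path.extend_apply η hτ, hγη])
      (hγC.differentiableOn (by norm_num) t ht).hasDerivWithinAt
      (hηC.differentiableOn (by norm_num) t ht).hasDerivWithinAt
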